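/- Let $d\ge 1$, $0<\alpha<1$ and $0<\gamma\le d$. A nonnegative Borel measure $\mu$ on $\mathbb R^d$ is called $\gamma$-dimensional if there is a finite constant $C_\mu\ge 0$ with $\mu(B(x,r))\le C_\mu r^\gamma$ for all $x\in\mathbb R^d$ and $r>0$, where $B(x,r)=\{y\in\mathbb R^d:|x-y|<r\}$; $\langle\mu\rangle_\gamma$ denotes the infimum of such constants. For $f\in L^2(\mathbb R^d)$ let $\widehat f$ be its Fourier transform (normalized as $\widehat f(\xi)=\int_{\mathbb R^d} e^{-ix\cdot\xi}f(x)\,dx$ for integrable $f$), and when $\widehat f$ has compact support put $$e^{it(-\Delta)^{\alpha/2}}f(x)=(2\pi)^{-d}\int_{\mathbb R^d} e^{i(x\cdot\xi+t|\xi|^\alpha)}\,\widehat f(\xi)\,d\xi ,\qquad x\in\mathbb R^d,\ t\in\mathbb R.$$ Suppose $$s>\min\Big\{\max\Big\{0,\ \alpha\Big(\frac\gamma2-\frac d4\Big)\Big\},\ \frac\alpha2\Big\}.$$ Then there is a constant $C>0$, depending only on $d,\alpha,\gamma,s$, such that $$\Big\|\sup_{0<t\le1}\big|e^{it(-\Delta)^{\alpha/2}}f\big|\Big\|_{L^2(B(0,1),\,d\mu)}\le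 C\,R^{\frac{d-\gamma}2+s}\,\langle\mu\rangle_\gamma^{1/2}\,\|f\|_{L^2(\mathbb R^d)}$$ for every $\gamma$-dimensional measure $\mu$ on $\mathbb R^d$, every $R\ge1$, and every $f\in L^2(\mathbb R^d)$ such that $\widehat f$ is supported in $\{\xi\in\mathbb R^d: R\le|\xi|\le 2R\}$. -/

import Mathlib

open MeasureTheory Metric Set
open scoped FourierTransform ENNReal NNReal

/-- The space `ℝ^d` with its Euclidean norm, inner product and Borel `σ`-algebra. -/
abbrev Rd (d : ℕ) : Type := EuclideanSpace ℝ (Fin d)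

/-- `C` is an admissible constant for `μ`: `μ (B(x,r)) ≤ C * r ^ γ` for all `x` and all `r > 0`. -/
def IsBallBound {d : ℕ} (γ : ℝ) (μ : Measure (Rd d)) (C : ℝ≥0) : Prop :=
  ∀ (x : Rd d) (r : ℝ), 0 < r → μ (ball x r) ≤ ENNReal.ofReal ((C : ℝ) * r ^ γ)

/-- The Borel measure `μ` on `ℝ^d` is `γ`-dimensional. -/
def IsGammaDimensional {d : ℕ} (γ : ℝ) (μ : Measure (Rd d)) : Prop :=
  ∃ C : ℝ≥0, IsBallBound γ μ C

/-- `⟨μ⟩_γ`, the infimum of the constants `C` with `μ (B(x,r)) ≤ C * r ^ γ` for all `x`, `r > 0`. -/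
noncomputable def dimConst {d : ℕ} (γ : ℝ) (μ : Measure (Rd d)) : ℝ≥0 :=
  sInf {C : ℝ≥0 | IsBallBound γ μ C}

/-- For `f ∈ L²(ℝ^d)`: the Fourier transform of `f` is supported in `{ξ : R ≤ |ξ| ≤ 2R}`.
Here `𝓕 f` is the Plancherel transform with kernel `exp (-2πi ⟨x, η⟩)`, so that the frequency
variable `ξ` dual to `x` in `exp (i ⟨x, ξ⟩)` is `ξ = 2πη`. The annulus is closed, so containing
the support means vanishing almost everywhere outside. -/
def FourierSupportedInAnnulus {d : ℕ} (R : ℝ) (f : Lp ℂ 2 (volume : Measure (Rd d))) : Prop :=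
  ∀ᵐ η : Rd d, ¬ (R ≤ 2 * Real.pi * ‖η‖ ∧ 2 * Real.pi * ‖η‖ ≤ 2 * R) →
    (𝓕 f : Lp ℂ 2 (volume : Measure (Rd d))) η = 0

/-- `exp (i t (-Δ)^{α/2}) f (x)`, for `f ∈ L²(ℝ^d)` whose Fourier transform has compact support:
the inverse Fourier integral of `exp (i t |ξ|^α)` times the Fourier transform of `f`, with
`ξ = 2πη`. The integral converges absolutely for every `x` (a function in `L²` with compact
support is integrable), so that this is the continuous representative of the `L²` function. -/
noncomputable def fracSchrodinger {d : ℕ} (α t : ℝ) (f : Lp ℂ 2 (volume : Measure (Rd d)))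
    (x : Rd d) : ℂ :=
  𝓕⁻ (fun η : Rd d => Complex.exp (Complex.I * ((t * (2 * Real.pi * ‖η‖) ^ α : ℝ) : ℂ)) *
    (𝓕 f : Lp ℂ 2 (volume : Measure (Rd d))) η) x

/-- The maximal function `sup_{0 < t ≤ 1} |exp (i t (-Δ)^{α/2}) f (x)|`, with values in `[0, ∞]`. -/
noncomputable def maximalFunction {d : ℕ} (α : ℝ) (f : Lp ℂ 2 (volume : Measure (Rd d)))
    (x : Rd d) : ℝ≥0∞ :=
  ⨆ t ∈ Ioc (0 : ℝ) 1, ‖fracSchrodinger α t f x‖ₑ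

/-! The supremum is linearised: it suffices to bound `fracSchrodinger α (τ x) f x` in `L²(μ)` on the
unit ball for every measurable choice of times `τ`, with a constant independent of `τ`
(`measurable_iSup_and_lintegral_iSup_sq_le`). By `TT*` (`lintegral_enorm_sq_le_of_schur`) this
follows from a Schur bound on the kernel, which after rescaling is `R ^ d` times a constant times
`annulusKernel` at time `(τ x - τ y) * R ^ α` and position `R • (x - y)`.

If the kernel is at most `B (1 + ‖w‖) ^ (-p)` for some `p > γ`, a dyadic decomposition
(`exists_lintegral_one_add_rpow_le`) bounds the Schur integral, and so the squared norm, by a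
multiple of `B * R ^ (d - γ)` times the constant of `μ`. Everything therefore rests on the size of
`B`.

Used once on the whole of `(0, 1]`, the argument meets rescaled times up to `T = R ^ α`. Two facts
control the kernel there: decay `‖w‖ ^ (-d/2)` uniformly in time
(`exists_norm_annulusKernel_le_rpow`) and rapid decay once `‖w‖` is much larger than `1 + |t|`
(`exists_norm_pow_mul_norm_annulusKernel_le`). Only `‖w‖` up to about `T` matters, so `B` is about
`T` to any positive power exceeding `γ - d/2`. This yields the condition `s > max 0 (α (γ/2 -
d/4))`. Alternatively, `(0, 1]` is cut into about `R ^ α` intervals on which rescaled times stay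
below one and `B` is a constant; adding the squares costs `R ^ α`, whence `s > α/2`.

The uniform decay is one-dimensional. In polar coordinates the kernel becomes a radial integral
against a Bessel-type function, which is written as two waves `exp (± i r)` with slowly varying
amplitudes. The resulting phase `t ρ ^ α ± X ρ` has either a large first derivative or, because `0 <
α < 1`, a large second derivative of constant sign, and van der Corput's tests apply. -/

open scoped ContDiff

/-! ### Van der Corput estimates in one variable. -/

/-- Van der Corput's first derivative test with a monotone derivative. -/
theorem norm_integral_cexp_le_of_abs_deriv_ge {φ φ' φ'' : ℝ → ℝ} {p q Λ : ℝ} (hpq : p ≤ q)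
    (hΛ : 0 < Λ) (h1 : ∀ x ∈ Icc p q, HasDerivAt φ (φ' x) x)
    (h2 : ∀ x ∈ Icc p q, HasDerivAt φ' (φ'' x) x) (hc : ContinuousOn φ'' (Icc p q))
    (hnn : ∀ x ∈ Icc p q, 0 ≤ φ'' x) (hge : ∀ x ∈ Icc p q, Λ ≤ |φ' x|) :
    ‖∫ x in p..q, Complex.exp (Complex.I * (φ x : ℂ))‖ ≤ 4 / Λ := by
  have hne : ∀ x ∈ Icc p q, φ' x ≠ 0 := fun x hx h => by
    have := hge x hx; rw [h, abs_zero] at this; linarith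
  have hc1 : ContinuousOn φ' (Icc p q) := fun x hx => (h2 x hx).continuousAt.continuousWithinAt
  have hc0 : ContinuousOn φ (Icc p q) := fun x hx => (h1 x hx).continuousAt.continuousWithinAt
  have hinv : ∀ x ∈ Icc p q, |(φ' x)⁻¹| ≤ 1 / Λ := fun x hx => by
    rw [abs_inv, one_div]; exact inv_anti₀ hΛ (hge x hx)
  have huI : uIcc p q = Icc p q := uIcc_of_le hpq
  -- Here `u = 1 / (i φ')`, so that `v = u * v'` and one integration by parts gains `1 / φ'`.
  set u : ℝ → ℂ := fun x => -Complex.I * (((φ' x)⁻¹ : ℝ) : ℂ) with hu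
  set u' : ℝ → ℂ := fun x => -Complex.I * ((-φ'' x / (φ' x) ^ 2 : ℝ) : ℂ) with hu'
  set v : ℝ → ℂ := fun x => Complex.exp (Complex.I * (φ x : ℂ)) with hv
  set v' : ℝ → ℂ := fun x => Complex.exp (Complex.I * (φ x : ℂ)) * (Complex.I * (φ' x : ℂ)) with hv'
  have hnv : ∀ x, ‖v x‖ = 1 := fun x => by
    simp only [hv]; rw [mul_comm]; exact Complex.norm_exp_ofReal_mul_I _
  have hdu : ∀ x ∈ uIcc p q, HasDerivAt u (u' x) x := fun x hx => by
    rw [huI] at hx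
    exact (((h2 x hx).fun_inv (hne x hx)).ofReal_comp).const_mul _
  have hdv : ∀ x ∈ uIcc p q, HasDerivAt v (v' x) x := fun x hx => by
    rw [huI] at hx
    exact (((h1 x hx).ofReal_comp).const_mul _).cexp
  have hcr : ContinuousOn (fun x => -φ'' x / (φ' x) ^ 2) (Icc p q) :=
    hc.neg.div (hc1.pow 2) (fun x hx => pow_ne_zero _ (hne x hx))
  have hcu' : ContinuousOn u' (Icc p q) :=
    continuousOn_const.mul (Complex.continuous_ofReal.comp_continuousOn hcr)
  have hcv : ContinuousOn v (Icc p q) :=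
    (continuousOn_const.mul (Complex.continuous_ofReal.comp_continuousOn hc0)).cexp
  have hcv' : ContinuousOn v' (Icc p q) :=
    hcv.mul (continuousOn_const.mul (Complex.continuous_ofReal.comp_continuousOn hc1))
  have hparts := intervalIntegral.integral_mul_deriv_eq_deriv_mul hdu hdv
    (by rw [← huI] at hcu'; exact hcu'.intervalIntegrable)
    (by rw [← huI] at hcv'; exact hcv'.intervalIntegrable)
  have heq : ∫ x in p..q, v x = ∫ x in p..q, u x * v' x := by
    apply intervalIntegral.integral_congr
    intro x hx
    rw [huI] at hx
    have : ((φ' x : ℝ) : ℂ) ≠ 0 := by exact_mod_cast hne x hx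
    simp only [hu, hv, hv', Complex.ofReal_inv]
    field_simp
    rw [Complex.I_sq]; ring
  have hint : IntervalIntegrable (fun x => -φ'' x / (φ' x) ^ 2) volume p q := by
    rw [← huI] at hcr; exact hcr.intervalIntegrable
  have hftc : ∫ x in p..q, -φ'' x / (φ' x) ^ 2 = (φ' q)⁻¹ - (φ' p)⁻¹ :=
    intervalIntegral.integral_eq_sub_of_hasDerivAt
      (fun x hx => by rw [huI] at hx; exact (h2 x hx).fun_inv (hne x hx)) hint
  have hp : p ∈ Icc p q := ⟨le_refl _, hpq⟩
  have hq : q ∈ Icc p q := ⟨hpq, le_refl _⟩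
  have hbd : ‖∫ x in p..q, u' x * v x‖ ≤ 2 / Λ := by
    -- As `φ''` has a sign, the absolute value of `(1 / φ')'` is `-(1 / φ')'`, whose integral is a
    -- difference of boundary values.
    have : ‖∫ x in p..q, u' x * v x‖ ≤ ∫ x in p..q, -(-φ'' x / (φ' x) ^ 2) := by
      apply intervalIntegral.norm_integral_le_of_norm_le hpq _ hint.neg
      refine Filter.Eventually.of_forall fun x hx => ?_
      have hx' : x ∈ Icc p q := ⟨hx.1.le, hx.2⟩
      rw [norm_mul, hnv, mul_one]
      simp only [hu', norm_mul, norm_neg, Complex.norm_I, one_mul, Complex.norm_real,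
        Real.norm_eq_abs]
      simp only [Pi.neg_apply]
      rw [neg_div, abs_neg, neg_neg, abs_of_nonneg (div_nonneg (hnn x hx') (sq_nonneg _))]
    rw [intervalIntegral.integral_neg, hftc] at this
    have a1 := (abs_le.1 (hinv p hp)).2
    have a2 := (abs_le.1 (hinv q hq)).1
    have : (2 : ℝ) / Λ = 1 / Λ + 1 / Λ := by ring
    linarith
  have hnu : ∀ x ∈ Icc p q, ‖u x * v x‖ ≤ 1 / Λ := fun x hx => by
    rw [norm_mul, hnv, mul_one]
    simp only [hu, norm_mul, norm_neg, Complex.norm_I, one_mul, Complex.norm_real,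
      Real.norm_eq_abs]
    exact hinv x hx
  rw [heq, hparts]
  calc _ ≤ ‖u q * v q‖ + ‖u p * v p‖ + ‖∫ x in p..q, u' x * v x‖ :=
        (norm_sub_le _ _).trans (by gcongr; exact norm_sub_le _ _)
    _ ≤ 1 / Λ + 1 / Λ + 2 / Λ := by gcongr; exacts [hnu q hq, hnu p hp]
    _ = 4 / Λ := by ring

/-- Van der Corput's second derivative test. -/
theorem norm_integral_cexp_le_of_deriv2_ge {φ φ' φ'' : ℝ → ℝ} {p q l : ℝ} (hpq : p ≤ q)
    (hl : 0 < l) (h1 : ∀ x ∈ Icc p q, HasDerivAt φ (φ' x) x)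
    (h2 : ∀ x ∈ Icc p q, HasDerivAt φ' (φ'' x) x) (hc : ContinuousOn φ'' (Icc p q))
    (hge : ∀ x ∈ Icc p q, l ≤ φ'' x) :
    ‖∫ x in p..q, Complex.exp (Complex.I * (φ x : ℂ))‖ ≤ 10 / √l := by
  have hc1 : ContinuousOn φ' (Icc p q) := fun x hx => (h2 x hx).continuousAt.continuousWithinAt
  have hc0 : ContinuousOn φ (Icc p q) := fun x hx => (h1 x hx).continuousAt.continuousWithinAt
  have hcv : ContinuousOn (fun x => Complex.exp (Complex.I * (φ x : ℂ))) (Icc p q) :=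
    (continuousOn_const.mul (Complex.continuous_ofReal.comp_continuousOn hc0)).cexp
  have hsl : 0 < √l := Real.sqrt_pos.2 hl
  have hss : √l * √l = l := Real.mul_self_sqrt hl.le
  -- `φ'` grows at rate at least `l`, so `|φ'| ≥ √l` at distance `1 / √l` from its zero. Each side
  -- of the zero costs `1 / √l` for the excluded piece and `4 / √l` from the first derivative test.
  have hgrow : ∀ x ∈ Icc p q, ∀ y ∈ Icc p q, x ≤ y → l * (y - x) ≤ φ' y - φ' x := by
    intro x hx y hy hxy
    apply (convex_Icc p q).mul_sub_le_image_sub_of_le_deriv hc1 _ _ x hx y hy hxy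
    · intro z hz
      exact (h2 z (interior_subset hz)).differentiableAt.differentiableWithinAt
    · intro z hz
      rw [(h2 z (interior_subset hz)).deriv]; exact hge z (interior_subset hz)
  have hii : ∀ x ∈ Icc p q, ∀ y ∈ Icc p q, IntervalIntegrable
      (fun x => Complex.exp (Complex.I * (φ x : ℂ))) volume x y := fun x hx y hy =>
    (hcv.mono (uIcc_subset_Icc hx hy)).intervalIntegrable
  have htriv : ∀ x y, x ≤ y →
      ‖∫ x in x..y, Complex.exp (Complex.I * (φ x : ℂ))‖ ≤ y - x := by
    intro x y hxy
    have := intervalIntegral.norm_integral_le_of_norm_le_const (a := x) (b := y) (C := 1)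
      (f := fun x => Complex.exp (Complex.I * (φ x : ℂ)))
      (fun z _ => by rw [mul_comm, Complex.norm_exp_ofReal_mul_I])
    rwa [one_mul, abs_of_nonneg (sub_nonneg.2 hxy)] at this
  have hfirst : ∀ x ∈ Icc p q, ∀ y ∈ Icc p q, x ≤ y → (∀ z ∈ Icc x y, √l ≤ |φ' z|) →
      ‖∫ x in x..y, Complex.exp (Complex.I * (φ x : ℂ))‖ ≤ 4 / √l := by
    intro x hx y hy hxy hz
    have hsub : Icc x y ⊆ Icc p q := Icc_subset_Icc hx.1 hy.2
    exact norm_integral_cexp_le_of_abs_deriv_ge hxy hsl (fun z hz => h1 z (hsub hz))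
      (fun z hz => h2 z (hsub hz)) (hc.mono hsub) (fun z hz => hl.le.trans (hge z (hsub hz))) hz
  have h45 : 5 / √l = 1 / √l + 4 / √l := by ring
  have hdel : l * (1 / √l) = √l := by
    nth_rewrite 1 [← hss]; field_simp
  have hright : ∀ c ∈ Icc p q, (0 ≤ φ' c ∨ c = q) →
      ‖∫ x in c..q, Complex.exp (Complex.I * (φ x : ℂ))‖ ≤ 5 / √l := by
    intro c hcm h0
    have hqm : q ∈ Icc p q := ⟨hpq, le_refl _⟩
    have hpos : 0 < 1 / √l := by positivity
    have hpos' : 0 < 4 / √l := by positivity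
    by_cases hcq : q ≤ c + 1 / √l
    · exact (htriv c q hcm.2).trans (by linarith)
    · push Not at hcq
      have h0 : 0 ≤ φ' c := by
        rcases h0 with h | h
        · exact h
        · linarith
      have hm : c + 1 / √l ∈ Icc p q := ⟨by linarith [hcm.1], hcq.le⟩
      rw [← intervalIntegral.integral_add_adjacent_intervals (hii c hcm _ hm) (hii _ hm q hqm), h45]
      refine (norm_add_le _ _).trans (add_le_add ((htriv _ _ (by linarith)).trans (by linarith)) ?_)
      refine hfirst _ hm q hqm hcq.le fun z hz => ?_
      have hz' : z ∈ Icc p q := ⟨hm.1.trans hz.1, hz.2⟩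
      have := hgrow c hcm z hz' (by linarith [hz.1])
      have h3 : l * (1 / √l) ≤ l * (z - c) := by
        apply mul_le_mul_of_nonneg_left _ hl.le; linarith [hz.1]
      rw [hdel] at h3
      exact le_trans (by linarith) (le_abs_self _)
  have hleft : ∀ c ∈ Icc p q, (φ' c ≤ 0 ∨ c = p) →
      ‖∫ x in p..c, Complex.exp (Complex.I * (φ x : ℂ))‖ ≤ 5 / √l := by
    intro c hcm h0
    have hqm : p ∈ Icc p q := ⟨le_refl _, hpq⟩
    have hpos : 0 < 1 / √l := by positivity
    have hpos' : 0 < 4 / √l := by positivity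
    by_cases hcq : c - 1 / √l ≤ p
    · exact (htriv p c hcm.1).trans (by linarith)
    · push Not at hcq
      have h0 : φ' c ≤ 0 := by
        rcases h0 with h | h
        · exact h
        · linarith
      have hm : c - 1 / √l ∈ Icc p q := ⟨hcq.le, by linarith [hcm.2]⟩
      rw [← intervalIntegral.integral_add_adjacent_intervals (hii p hqm _ hm) (hii _ hm c hcm), h45,
        add_comm (1 / √l)]
      refine (norm_add_le _ _).trans (add_le_add ?_ ((htriv _ _ (by linarith)).trans (by linarith)))
      refine hfirst p hqm _ hm hcq.le fun z hz => ?_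
      have hz' : z ∈ Icc p q := ⟨hz.1, hz.2.trans hm.2⟩
      have := hgrow z hz' c hcm (by linarith [hz.2])
      have h3 : l * (1 / √l) ≤ l * (c - z) := by
        apply mul_le_mul_of_nonneg_left _ hl.le; linarith [hz.2]
      rw [hdel] at h3
      exact le_trans (by linarith) (neg_le_abs _)
  have hpm : p ∈ Icc p q := ⟨le_refl _, hpq⟩
  have hqm : q ∈ Icc p q := ⟨hpq, le_refl _⟩
  -- The splitting point is a zero of `φ'`, or an endpoint when `φ'` does not change sign; one of
  -- the two pieces is then empty.
  have key : ∃ c ∈ Icc p q, (φ' c ≤ 0 ∨ c = p) ∧ (0 ≤ φ' c ∨ c = q) := by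
    by_cases hp : 0 ≤ φ' p
    · exact ⟨p, hpm, Or.inr rfl, Or.inl hp⟩
    by_cases hq : φ' q ≤ 0
    · exact ⟨q, hqm, Or.inl hq, Or.inr rfl⟩
    push Not at hp hq
    obtain ⟨c, hcm, hc0⟩ := intermediate_value_Icc hpq hc1 ⟨hp.le, hq.le⟩
    exact ⟨c, hcm, Or.inl hc0.le, Or.inl hc0.ge⟩
  obtain ⟨c, hcm, hcl, hcr⟩ := key
  rw [← intervalIntegral.integral_add_adjacent_intervals (hii p hpm c hcm) (hii c hcm q hqm)]
  calc _ ≤ 5 / √l + 5 / √l := (norm_add_le _ _).trans (add_le_add (hleft c hcm hcl) (hright c hcm hcr))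
    _ = 10 / √l := by ring

/-- An oscillatory integral with amplitude is controlled by the integrals without amplitude. -/
theorem norm_integral_mul_le_of_primitive_le {e b b' : ℝ → ℂ} {p q M B : ℝ} (hpq : p ≤ q)
    (he : Continuous e)
    (hM : ∀ x ∈ Icc p q, ‖∫ y in p..x, e y‖ ≤ M)
    (hb : ∀ x ∈ Icc p q, HasDerivAt b (b' x) x) (hb'c : ContinuousOn b' (Icc p q))
    (hbq : ‖b q‖ ≤ B) (hb' : ∀ x ∈ Icc p q, ‖b' x‖ ≤ B) :
    ‖∫ x in p..q, e x * b x‖ ≤ M * B * (1 + (q - p)) := by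
  have huI : uIcc p q = Icc p q := uIcc_of_le hpq
  have hM0 : 0 ≤ M := (norm_nonneg _).trans (hM q ⟨hpq, le_refl _⟩)
  have hE : ∀ x, HasDerivAt (fun x => ∫ y in p..x, e y) (e x) x := fun x =>
    intervalIntegral.integral_hasDerivAt_right (he.intervalIntegrable _ _)
      he.aestronglyMeasurable.stronglyMeasurableAtFilter he.continuousAt
  have hparts := intervalIntegral.integral_deriv_mul_eq_sub
    (u := fun x => ∫ y in p..x, e y) (v := b) (u' := e) (v' := b') (a := p) (b := q)
    (fun x _ => hE x) (fun x hx => hb x (huI ▸ hx)) (he.intervalIntegrable _ _)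
    (by rw [← huI] at hb'c; exact hb'c.intervalIntegrable)
  have hEc : Continuous (fun x => ∫ y in p..x, e y) :=
    continuous_iff_continuousAt.2 fun x => (hE x).continuousAt
  have hbc : ContinuousOn b (Icc p q) := fun x hx => (hb x hx).continuousAt.continuousWithinAt
  have hi1 : IntervalIntegrable (fun x => e x * b x) volume p q := by
    apply ContinuousOn.intervalIntegrable; rw [huI]; exact he.continuousOn.mul hbc
  have hi2 : IntervalIntegrable (fun x => (∫ y in p..x, e y) * b' x) volume p q := by
    apply ContinuousOn.intervalIntegrable; rw [huI]; exact hEc.continuousOn.mul hb'c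
  rw [intervalIntegral.integral_add hi1 hi2] at hparts
  have : ∫ x in p..q, e x * b x =
      (∫ y in p..q, e y) * b q - ∫ x in p..q, (∫ y in p..x, e y) * b' x := by
    rw [intervalIntegral.integral_same, zero_mul, sub_zero] at hparts
    rw [← hparts]; ring
  rw [this]
  have h2 : ‖∫ x in p..q, (∫ y in p..x, e y) * b' x‖ ≤ M * B * |q - p| := by
    apply intervalIntegral.norm_integral_le_of_norm_le_const
    intro x hx
    rw [uIoc_of_le hpq] at hx
    have hx' : x ∈ Icc p q := ⟨hx.1.le, hx.2⟩
    rw [norm_mul]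
    exact mul_le_mul (hM x hx') (hb' x hx') (norm_nonneg _) hM0
  rw [abs_of_nonneg (sub_nonneg.2 hpq)] at h2
  have h1 : ‖(∫ y in p..q, e y) * b q‖ ≤ M * B := by
    rw [norm_mul]; exact mul_le_mul (hM q ⟨hpq, le_refl _⟩) hbq (norm_nonneg _) hM0
  calc _ ≤ _ := norm_sub_le _ _
    _ ≤ M * B + M * B * (q - p) := add_le_add h1 h2
    _ = _ := by ring

/-! ### Bessel profiles and radial oscillatory integrals. -/

/-- `J` solves the radial Helmholtz equation `J'' + (2m/r) J' + J = 0` on `(0, ∞)`,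
with derivative `J'`. -/
structure IsBesselProfile (m : ℝ) (J J' : ℝ → ℝ) : Prop where
  hasDerivAt : ∀ r, 0 < r → HasDerivAt J (J' r) r
  hasDerivAt' : ∀ r, 0 < r → HasDerivAt J' (-(J r) - 2 * m / r * J' r) r

theorem isBesselProfile_cos : IsBesselProfile 0 Real.cos (fun r => -Real.sin r) where
  hasDerivAt r _ := Real.hasDerivAt_cos r
  hasDerivAt' r _ := by
    simpa using (Real.hasDerivAt_sin r).fun_neg

/-- Energy estimate for `h'' + h = (c / r²) h`. -/
theorem sq_add_sq_le_of_deriv2 {h h1 : ℝ → ℝ} {c : ℝ}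
    (hd : ∀ r, 0 < r → HasDerivAt h (h1 r) r)
    (hd1 : ∀ r, 0 < r → HasDerivAt h1 (-(h r) + c / r ^ 2 * h r) r) {r : ℝ} (hr : 1 / 2 ≤ r) :
    h r ^ 2 + h1 r ^ 2 ≤ (h (1 / 2) ^ 2 + h1 (1 / 2) ^ 2) * Real.exp (2 * |c|) := by
  -- The weight is an integrating factor: its derivative contributes `-|c| / r ^ 2` times the energy
  -- and absorbs the cross term `2 c h h' / r ^ 2`. It is at least `1` everywhere and equals `exp (2
  -- |c|)` at `1/2`.
  set E : ℝ → ℝ := fun r => (h r ^ 2 + h1 r ^ 2) * Real.exp (|c| * r⁻¹) with hE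
  have hdE : ∀ r, 0 < r → HasDerivAt E
      ((2 * h r * h1 r + 2 * h1 r * (-(h r) + c / r ^ 2 * h r)) * Real.exp (|c| * r⁻¹) +
        (h r ^ 2 + h1 r ^ 2) * (Real.exp (|c| * r⁻¹) * (|c| * -(r ^ 2)⁻¹))) r := by
    intro r hr
    have e1 := ((hd r hr).fun_pow 2).fun_add ((hd1 r hr).fun_pow 2)
    have e2 := (((hasDerivAt_inv hr.ne').const_mul |c|).exp)
    refine (e1.fun_mul e2).congr_deriv ?_
    simp
  have hanti : AntitoneOn E (Ici (1 / 2)) := by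
    apply antitoneOn_of_deriv_nonpos (convex_Ici _)
    · intro x hx
      exact (hdE x (lt_of_lt_of_le (by norm_num) hx)).continuousAt.continuousWithinAt
    · intro x hx
      rw [interior_Ici] at hx
      exact (hdE x (lt_trans (by norm_num) hx)).differentiableAt.differentiableWithinAt
    · intro x hx
      rw [interior_Ici] at hx
      have hx0 : 0 < x := lt_trans (by norm_num) hx
      rw [(hdE x hx0).deriv]
      have : (2 * h x * h1 x + 2 * h1 x * (-(h x) + c / x ^ 2 * h x)) * Real.exp (|c| * x⁻¹) +
        (h x ^ 2 + h1 x ^ 2) * (Real.exp (|c| * x⁻¹) * (|c| * -(x ^ 2)⁻¹)) =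
        Real.exp (|c| * x⁻¹) / x ^ 2 * (c * (2 * h x * h1 x) - |c| * (h x ^ 2 + h1 x ^ 2)) := by
        field_simp; ring
      rw [this]
      apply mul_nonpos_of_nonneg_of_nonpos (by positivity)
      have h2 : |2 * h x * h1 x| ≤ h x ^ 2 + h1 x ^ 2 := by
        rw [abs_le]; constructor <;> nlinarith [sq_nonneg (h x + h1 x), sq_nonneg (h x - h1 x)]
      have h3 := le_abs_self (c * (2 * h x * h1 x))
      rw [abs_mul] at h3
      have := mul_le_mul_of_nonneg_left h2 (abs_nonneg c)
      linarith
  have := hanti (mem_Ici.2 (le_refl _)) (mem_Ici.2 hr) hr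
  have hr0 : 0 < r := lt_of_lt_of_le (by norm_num) hr
  calc h r ^ 2 + h1 r ^ 2 ≤ E r := by
        apply le_mul_of_one_le_right (by positivity)
        exact Real.one_le_exp (by positivity)
    _ ≤ E (1 / 2) := this
    _ = _ := by simp only [hE]; norm_num; ring_nf; simp

/-- Asymptotic form of a Bessel profile: two oscillating waves with slowly varying amplitudes. -/
theorem IsBesselProfile.exists_amplitudes {m : ℝ} {J J' : ℝ → ℝ} (hJ : IsBesselProfile m J J') :
    ∃ (A : ℝ) (a a' : ℝ → ℝ → ℂ), 0 ≤ A ∧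
      (∀ ε : ℝ, |ε| = 1 → ∀ r, 0 < r → HasDerivAt (a ε) (a' ε r) r) ∧
      (∀ ε, ContinuousOn (a' ε) (Ioi 0)) ∧
      (∀ ε : ℝ, |ε| = 1 → ∀ r, 1 / 2 ≤ r → ‖a ε r‖ ≤ A) ∧
      (∀ ε : ℝ, |ε| = 1 → ∀ r, 1 / 2 ≤ r → ‖a' ε r‖ ≤ A / r ^ 2) ∧
      ∀ r, 0 < r → ((r ^ m * J r : ℝ) : ℂ) =
        Complex.exp (Complex.I * (r : ℂ)) * a 1 r + Complex.exp (Complex.I * (-r : ℂ)) * a (-1) r := by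
  -- Multiplying by `r ^ m` removes the first-order term: `h = r ^ m J` solves `h'' + h = (c / r ^
  -- 2) h`.
  set c := m * (m - 1) with hc
  set h : ℝ → ℝ := fun r => r ^ m * J r with hh
  set h1 : ℝ → ℝ := fun r => r ^ m * (m * r⁻¹ * J r + J' r) with hh1
  have hrp : ∀ r : ℝ, 0 < r → HasDerivAt (fun r : ℝ => r ^ m) (r ^ m * (m * r⁻¹)) r := by
    intro r hr
    refine (Real.hasDerivAt_rpow_const (p := m) (Or.inl hr.ne')).congr_deriv ?_
    rw [Real.rpow_sub_one hr.ne']; ring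
  have hd : ∀ r, 0 < r → HasDerivAt h (h1 r) r := by
    intro r hr
    refine ((hrp r hr).fun_mul (hJ.hasDerivAt r hr)).congr_deriv ?_
    simp only [hh1]; ring
  have hd1 : ∀ r, 0 < r → HasDerivAt h1 (-(h r) + c / r ^ 2 * h r) r := by
    intro r hr
    have e := (hrp r hr).fun_mul (((((hasDerivAt_inv hr.ne').const_mul m).fun_mul
      (hJ.hasDerivAt r hr)).fun_add (hJ.hasDerivAt' r hr)))
    refine e.congr_deriv ?_
    simp only [hh, hc]
    field_simp
    ring
  set D := (h (1 / 2) ^ 2 + h1 (1 / 2) ^ 2) * Real.exp (2 * |c|) with hD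
  have hD0 : 0 ≤ D := by positivity
  have hen : ∀ r, 1 / 2 ≤ r → |h r| ≤ √D ∧ |h1 r| ≤ √D := by
    intro r hr
    have := sq_add_sq_le_of_deriv2 hd hd1 hr
    constructor <;> apply Real.abs_le_sqrt <;> nlinarith [sq_nonneg (h r), sq_nonneg (h1 r)]
  have hexp : ∀ x y : ℝ, ‖Complex.exp (-Complex.I * ((x * y : ℝ) : ℂ))‖ = 1 := by
    intro x y
    rw [show -Complex.I * ((x * y : ℝ) : ℂ) = ((-(x * y) : ℝ) : ℂ) * Complex.I by push_cast; ring]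
    exact Complex.norm_exp_ofReal_mul_I _
  -- Variation of constants: `a ε = exp (-i ε r) (h - i ε h') / 2` would be constant for `h'' + h =
  -- 0`, so its derivative contains only the perturbation `(c / r ^ 2) h`.
  refine ⟨√D * (1 + |c|), fun ε r => Complex.exp (-Complex.I * ((ε * r : ℝ) : ℂ)) *
      (((h r : ℝ) : ℂ) - Complex.I * ((ε * h1 r : ℝ) : ℂ)) / 2,
    fun ε r => -Complex.I * ε * Complex.exp (-Complex.I * ((ε * r : ℝ) : ℂ)) *
      ((c / r ^ 2 * h r : ℝ) : ℂ) / 2, by positivity, ?_, ?_, ?_, ?_, ?_⟩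
  · intro ε hε r hr
    have hε2 : (ε : ℂ) * ε = 1 := by
      have : ε * ε = 1 := by rw [← abs_mul_abs_self, hε, one_mul]
      exact_mod_cast this
    have e1 : HasDerivAt (fun r : ℝ => ((ε * r : ℝ) : ℂ)) ((ε * 1 : ℝ) : ℂ) r :=
      ((hasDerivAt_id r).const_mul ε).ofReal_comp
    have e2 := (e1.const_mul (-Complex.I)).cexp
    have e3 := ((hd r hr).ofReal_comp).fun_sub
      (((hd1 r hr).const_mul ε).ofReal_comp.const_mul Complex.I)
    refine ((e2.fun_mul e3).div_const 2).congr_deriv ?_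
    push_cast
    linear_combination (1 / 2 : ℂ) * Complex.exp (-Complex.I * (ε * r)) * h1 r *
      Complex.I ^ 2 * hε2 + (1 / 2 : ℂ) * Complex.exp (-Complex.I * (ε * r)) * h1 r * Complex.I_sq
  · intro ε
    have hch : ContinuousOn h (Ioi 0) := fun x hx => (hd x hx).continuousAt.continuousWithinAt
    have h1c : ContinuousOn (fun r : ℝ => c / r ^ 2 * h r) (Ioi 0) :=
      (continuousOn_const.div (continuousOn_id.pow 2) (fun x hx => pow_ne_zero _ (ne_of_gt hx))).mul hch
    have h2c : ContinuousOn (fun r : ℝ => -Complex.I * ε * Complex.exp (-Complex.I * ((ε * r : ℝ) : ℂ)))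
      (Ioi 0) := by fun_prop
    exact (h2c.mul (Complex.continuous_ofReal.comp_continuousOn h1c)).div_const _
  · intro ε hε r hr
    obtain ⟨k1, k2⟩ := hen r hr
    rw [norm_div, norm_mul, hexp, one_mul]
    have : ‖((h r : ℝ) : ℂ) - Complex.I * ((ε * h1 r : ℝ) : ℂ)‖ ≤ √D + √D := by
      refine (norm_sub_le _ _).trans (add_le_add ?_ ?_)
      · rwa [Complex.norm_real, Real.norm_eq_abs]
      · rwa [norm_mul, Complex.norm_I, one_mul, Complex.norm_real, Real.norm_eq_abs, abs_mul, hε,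
          one_mul]
    rw [Complex.norm_two, div_le_iff₀ (by norm_num)]
    have : 0 ≤ √D * |c| := by positivity
    linarith
  · intro ε hε r hr
    obtain ⟨k1, k2⟩ := hen r hr
    have hr0 : 0 < r := lt_of_lt_of_le (by norm_num) hr
    rw [norm_div, norm_mul, norm_mul, norm_mul, hexp, norm_neg, Complex.norm_I, Complex.norm_real,
      Complex.norm_real, Real.norm_eq_abs, Real.norm_eq_abs, hε, Complex.norm_two, abs_mul, abs_div,
      abs_of_pos (pow_pos hr0 2)]
    have h3 : |c| / r ^ 2 * |h r| ≤ |c| / r ^ 2 * √D := by gcongr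
    have h4 : √D * (1 + |c|) / r ^ 2 = √D / r ^ 2 + |c| / r ^ 2 * √D := by ring
    have h5 : 0 ≤ √D / r ^ 2 := by positivity
    have h6 : 0 ≤ |c| / r ^ 2 * √D := by positivity
    rw [h4]; linarith
  · intro r hr
    have e1 : Complex.exp (Complex.I * (r : ℂ)) * Complex.exp (-(Complex.I * (r : ℂ))) = 1 := by
      rw [← Complex.exp_add, add_neg_cancel, Complex.exp_zero]
    push_cast
    simp only [one_mul, neg_mul, mul_neg, neg_neg]
    have : ((h r : ℝ) : ℂ) = ((r ^ m : ℝ) : ℂ) * J r := by simp [hh]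
    rw [← this]
    linear_combination (-(h r : ℂ)) * e1

/-- Uniform bound for the phase `t ρ ^ α + ε X ρ` on `[1/2, 3]`, without amplitude. -/
theorem exists_norm_integral_phase_le {α : ℝ} (hα0 : 0 < α) (hα1 : α < 1) :
    ∃ M : ℝ, 0 ≤ M ∧ ∀ ε : ℝ, |ε| = 1 → ∀ t X : ℝ, 1 ≤ X → ∀ x ∈ Icc (1 / 2 : ℝ) 3,
      ‖∫ ρ in (1 / 2 : ℝ)..x, Complex.exp (Complex.I * ((t * ρ ^ α + ε * X * ρ : ℝ) : ℂ))‖ ≤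
        M / √X := by
  -- `36 = 4 * 9`: on the interval `y ^ (α - 2) ≥ 1/9`, so the second derivative is at least `4 * l0
  -- * |t|`, hence at least `l0 * X` when `|t| > X / 4`.
  set l0 := α * (1 - α) / 36 with hl0
  have hl0p : 0 < l0 := by have : 0 < 1 - α := by linarith
                           positivity
  -- For `t ≤ 0` the phase is convex, since `t α (α - 1) ≥ 0`. The other sign follows by complex
  -- conjugation, which flips both `t` and `ε`.
  have key : ∀ ε : ℝ, |ε| = 1 → ∀ t X : ℝ, t ≤ 0 → 1 ≤ X → ∀ x ∈ Icc (1 / 2 : ℝ) 3,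
      ‖∫ ρ in (1 / 2 : ℝ)..x, Complex.exp (Complex.I * ((t * ρ ^ α + ε * X * ρ : ℝ) : ℂ))‖ ≤
        (8 + 10 / √l0) / √X := by
    intro ε hε t X ht hX x hx
    have hX0 : 0 < X := by linarith
    have hsX : 0 < √X := Real.sqrt_pos.2 hX0
    have hpos : ∀ y ∈ Icc (1 / 2 : ℝ) x, 0 < y := fun y hy => lt_of_lt_of_le (by norm_num) hy.1
    have d1 : ∀ y ∈ Icc (1 / 2 : ℝ) x, HasDerivAt (fun ρ : ℝ => t * ρ ^ α + ε * X * ρ)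
        (t * (α * y ^ (α - 1)) + ε * X) y := by
      intro y hy
      have := (((Real.hasDerivAt_rpow_const (p := α) (Or.inl (hpos y hy).ne')).const_mul t)).fun_add
        ((hasDerivAt_id y).const_mul (ε * X))
      simpa using this
    have d2 : ∀ y ∈ Icc (1 / 2 : ℝ) x, HasDerivAt (fun ρ : ℝ => t * (α * ρ ^ (α - 1)) + ε * X)
        (t * (α * ((α - 1) * y ^ (α - 1 - 1)))) y := by
      intro y hy
      exact ((((Real.hasDerivAt_rpow_const (p := α - 1)
        (Or.inl (hpos y hy).ne')).const_mul α).const_mul t)).add_const _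
    have hc : ContinuousOn (fun y : ℝ => t * (α * ((α - 1) * y ^ (α - 1 - 1)))) (Icc (1 / 2 : ℝ) x) := by
      refine continuousOn_const.mul (continuousOn_const.mul (continuousOn_const.mul ?_))
      exact continuousOn_id.rpow_const fun y hy => Or.inl (hpos y hy).ne'
    have hlow : ∀ y ∈ Icc (1 / 2 : ℝ) x, 1 / 9 ≤ y ^ (α - 1 - 1) := by
      intro y hy
      have hy3 : y ≤ 3 := hy.2.trans hx.2
      calc (1 / 9 : ℝ) = (3 : ℝ) ^ (-2 : ℝ) := by
            rw [Real.rpow_neg (by norm_num)]; norm_num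
        _ ≤ (3 : ℝ) ^ (α - 1 - 1) := Real.rpow_le_rpow_of_exponent_le (by norm_num) (by linarith)
        _ ≤ y ^ (α - 1 - 1) := Real.rpow_le_rpow_of_nonpos (hpos y hy) hy3 (by linarith)
    have hmid : ∀ y ∈ Icc (1 / 2 : ℝ) x, α * ((1 - α) * y ^ (α - 1 - 1)) ≥ 4 * l0 := by
      intro y hy
      have h1 : 0 < α * (1 - α) := mul_pos hα0 (by linarith)
      have := mul_le_mul_of_nonneg_left (hlow y hy) h1.le
      rw [hl0]; linarith
    have heq : ∀ y, t * (α * ((α - 1) * y ^ (α - 1 - 1))) =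
        (-t) * (α * ((1 - α) * y ^ (α - 1 - 1))) := fun y => by ring
    -- For `|t| ≤ X / 4` the term `t ρ ^ α` has slope at most `X / 2`, so the linear term dominates
    -- and the phase is not stationary. Otherwise its curvature is used.
    rcases le_or_gt (-t) (X / 4) with hsm | hbig
    · have hfirst := norm_integral_cexp_le_of_abs_deriv_ge (Λ := X / 2) hx.1 (by positivity) d1 d2 hc
        (fun y hy => by
          rw [heq]
          exact mul_nonneg (by linarith) (by have := hmid y hy; linarith))
        (fun y hy => by
          have hyup : y ^ (α - 1) ≤ 2 := by
            calc y ^ (α - 1) ≤ (1 / 2 : ℝ) ^ (α - 1) :=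
                  Real.rpow_le_rpow_of_nonpos (by norm_num) hy.1 (by linarith)
              _ ≤ (1 / 2 : ℝ) ^ (-1 : ℝ) :=
                  Real.rpow_le_rpow_of_exponent_ge (by norm_num) (by norm_num) (by linarith)
              _ = 2 := by rw [Real.rpow_neg_one]; norm_num
          have hy0 : 0 ≤ y ^ (α - 1) := (Real.rpow_pos_of_pos (hpos y hy) _).le
          have h1 : |t * (α * y ^ (α - 1))| ≤ X / 2 := by
            rw [abs_mul, abs_of_nonpos ht, abs_of_nonneg (by positivity)]
            have : α * y ^ (α - 1) ≤ 1 * 2 := mul_le_mul hα1.le hyup hy0 zero_le_one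
            calc _ ≤ X / 4 * (1 * 2) := by gcongr
              _ = _ := by ring
          have h2 : |ε * X| = X := by rw [abs_mul, hε, abs_of_pos hX0, one_mul]
          have h3 := abs_sub_abs_le_abs_sub (ε * X) (-(t * (α * y ^ (α - 1))))
          rw [abs_neg, sub_neg_eq_add, add_comm (ε * X)] at h3
          linarith)
      refine hfirst.trans ?_
      have hX1 : √X ≤ X := by
        rw [Real.sqrt_le_left hX0.le]; nlinarith
      have : 0 ≤ 10 / √l0 / √X := by positivity
      have h8 : 4 / (X / 2) ≤ 8 / √X := by
        rw [show 4 / (X / 2) = 8 / X by field_simp; norm_num]; gcongr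
      rw [add_div]; linarith
    · have hsecond := norm_integral_cexp_le_of_deriv2_ge (l := l0 * X) hx.1 (by positivity) d1 d2 hc
        (fun y hy => by
          rw [heq]
          calc l0 * X = X / 4 * (4 * l0) := by ring
            _ ≤ _ := mul_le_mul hbig.le (hmid y hy) (by positivity) (by linarith))
      refine hsecond.trans ?_
      rw [Real.sqrt_mul hl0p.le, add_div, div_div]
      have : 0 ≤ 8 / √X := by positivity
      linarith
  refine ⟨8 + 10 / √l0, by positivity, fun ε hε t X hX x hx => ?_⟩
  rcases le_total t 0 with ht | ht
  · exact key ε hε t X ht hX x hx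
  · have := key (-ε) (by rwa [abs_neg]) (-t) X (by linarith) hX x hx
    convert this using 1
    rw [← RCLike.norm_conj, ← intervalIntegral.intervalIntegral_conj]
    congr 1
    apply intervalIntegral.integral_congr
    intro ρ _
    change (starRingEnd ℂ) (Complex.exp _) = _
    rw [← Complex.exp_conj, map_mul, Complex.conj_I, Complex.conj_ofReal]
    congr 1
    push_cast
    ring

/-- Decay of the radial oscillatory integrals against a Bessel profile. -/
theorem IsBesselProfile.exists_norm_integral_le {α m : ℝ} {J J' : ℝ → ℝ} (hα0 : 0 < α) (hα1 : α < 1)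
    (hJ : IsBesselProfile m J J') {g g' : ℝ → ℝ}
    (hg : ∀ x ∈ Icc (1 / 2 : ℝ) 3, HasDerivAt g (g' x) x) (hg' : ContinuousOn g' (Icc (1 / 2 : ℝ) 3)) :
    ∃ C : ℝ, 0 ≤ C ∧ ∀ t X : ℝ, 1 ≤ X →
      ‖∫ ρ in (1 / 2 : ℝ)..3, Complex.exp (Complex.I * ((t * ρ ^ α : ℝ) : ℂ)) *
        ((g ρ * ((ρ * X) ^ m * J (ρ * X)) : ℝ) : ℂ)‖ ≤ C / √X := by
  obtain ⟨A, a, a', hA, had, hac, hab, hab', hrep⟩ := hJ.exists_amplitudes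
  obtain ⟨M, hM0, hM⟩ := exists_norm_integral_phase_le hα0 hα1
  have hgc : ContinuousOn g (Icc (1 / 2 : ℝ) 3) := fun x hx => (hg x hx).continuousAt.continuousWithinAt
  obtain ⟨B1, hB1⟩ := isCompact_Icc.exists_bound_of_continuousOn hgc
  obtain ⟨B2, hB2⟩ := isCompact_Icc.exists_bound_of_continuousOn hg'
  set B := max B1 B2
  have hB : ∀ x ∈ Icc (1 / 2 : ℝ) 3, |g x| ≤ B := fun x hx => (hB1 x hx).trans (le_max_left _ _)
  have hB' : ∀ x ∈ Icc (1 / 2 : ℝ) 3, |g' x| ≤ B := fun x hx => (hB2 x hx).trans (le_max_right _ _)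
  have hB0 : 0 ≤ B := (abs_nonneg _).trans (hB 3 ⟨by norm_num, by norm_num⟩)
  have hpos : ∀ y ∈ Icc (1 / 2 : ℝ) 3, 0 < y := fun y hy => lt_of_lt_of_le (by norm_num) hy.1
  -- The factor `X` from the chain rule is beaten by the decay of `a'`: `A / (x X) ^ 2 * X ≤ 4 A`
  -- because `x ≥ 1/2` and `X ≥ 1`. The constant `5 = 1 + 4` adds the two terms of the product rule.
  have key : ∀ ε : ℝ, |ε| = 1 → ∀ t X : ℝ, 1 ≤ X →
      IntervalIntegrable (fun ρ : ℝ => Complex.exp (Complex.I * ((t * ρ ^ α + ε * X * ρ : ℝ) : ℂ)) *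
        ((g ρ : ℂ) * a ε (ρ * X))) volume (1 / 2) 3 ∧
      ‖∫ ρ in (1 / 2 : ℝ)..3, Complex.exp (Complex.I * ((t * ρ ^ α + ε * X * ρ : ℝ) : ℂ)) *
        ((g ρ : ℂ) * a ε (ρ * X))‖ ≤ M / √X * (5 * (B * A)) * (1 + (3 - 1 / 2)) := by
    intro ε hε t X hX
    have hX0 : 0 < X := by linarith
    have hda : ∀ x ∈ Icc (1 / 2 : ℝ) 3, HasDerivAt (fun ρ : ℝ => a ε (ρ * X)) (a' ε (x * X) * X) x := by
      intro x hx
      have e1 := had ε hε (x * X) (mul_pos (hpos x hx) hX0)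
      have e2 : HasDerivAt (fun ρ : ℝ => ρ * X) X x := by
        simpa using (hasDerivAt_id x).mul_const X
      have := e1.scomp x e2
      refine this.congr_deriv ?_
      simp [mul_comm]
    have hdb : ∀ x ∈ Icc (1 / 2 : ℝ) 3, HasDerivAt (fun ρ : ℝ => (g ρ : ℂ) * a ε (ρ * X))
        ((g' x : ℂ) * a ε (x * X) + (g x : ℂ) * (a' ε (x * X) * X)) x := fun x hx =>
      ((hg x hx).ofReal_comp).fun_mul (hda x hx)
    have hca : ContinuousOn (fun ρ : ℝ => a ε (ρ * X)) (Icc (1 / 2 : ℝ) 3) :=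
      fun x hx => (hda x hx).continuousAt.continuousWithinAt
    have hca' : ContinuousOn (fun ρ : ℝ => a' ε (ρ * X)) (Icc (1 / 2 : ℝ) 3) :=
      (hac ε).comp (continuousOn_id.mul continuousOn_const)
        (fun x hx => mul_pos (hpos x hx) hX0)
    have hcg := Complex.continuous_ofReal.comp_continuousOn hgc
    have hcg' := Complex.continuous_ofReal.comp_continuousOn hg'
    have hce : Continuous (fun ρ : ℝ => Complex.exp (Complex.I * ((t * ρ ^ α + ε * X * ρ : ℝ) : ℂ))) := by
      have := Real.continuous_rpow_const hα0.le
      fun_prop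
    have hXr : ∀ x ∈ Icc (1 / 2 : ℝ) 3, 1 / 2 ≤ x * X := fun x hx => by nlinarith [hx.1]
    refine ⟨?_, norm_integral_mul_le_of_primitive_le (M := M / √X) (by norm_num) hce
      (fun x hx => hM ε hε t X hX x hx) hdb ?_ ?_ ?_⟩
    · apply ContinuousOn.intervalIntegrable
      rw [uIcc_of_le (by norm_num)]
      exact hce.continuousOn.mul (hcg.mul hca)
    · exact (hcg'.mul hca).add (hcg.mul (hca'.mul continuousOn_const))
    · have h3 : (3 : ℝ) ∈ Icc (1 / 2 : ℝ) 3 := ⟨by norm_num, by norm_num⟩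
      rw [norm_mul, Complex.norm_real, Real.norm_eq_abs]
      have := mul_le_mul (hB 3 h3) (hab ε hε _ (hXr 3 h3)) (norm_nonneg _) hB0
      have : 0 ≤ B * A := by positivity
      linarith
    · intro x hx
      refine (norm_add_le _ _).trans ?_
      rw [norm_mul, norm_mul, norm_mul, Complex.norm_real, Complex.norm_real, Complex.norm_real,
        Real.norm_eq_abs, Real.norm_eq_abs, Real.norm_eq_abs, abs_of_pos hX0]
      have k1 := mul_le_mul (hB' x hx) (hab ε hε _ (hXr x hx)) (norm_nonneg _) hB0
      have k2 : ‖a' ε (x * X)‖ * X ≤ 4 * A := by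
        have hx0 := hpos x hx
        calc ‖a' ε (x * X)‖ * X ≤ A / (x * X) ^ 2 * X := by gcongr; exact hab' ε hε _ (hXr x hx)
          _ = A * (1 / (x ^ 2 * X)) := by field_simp
          _ ≤ A * 4 := by
            gcongr
            rw [div_le_iff₀ (by positivity)]
            have := hx.1
            nlinarith [mul_le_mul_of_nonneg_left hX (sq_nonneg x)]
          _ = 4 * A := by ring
      have k3 := mul_le_mul (hB x hx) k2 (by positivity) hB0
      linarith
  refine ⟨2 * (M * (5 * (B * A)) * (1 + (3 - 1 / 2))), by norm_num; positivity, fun t X hX => ?_⟩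
  have hX0 : 0 < X := by linarith
  obtain ⟨i1, n1⟩ := key 1 (by norm_num) t X hX
  obtain ⟨i2, n2⟩ := key (-1) (by norm_num) t X hX
  have : ∫ ρ in (1 / 2 : ℝ)..3, Complex.exp (Complex.I * ((t * ρ ^ α : ℝ) : ℂ)) *
        ((g ρ * ((ρ * X) ^ m * J (ρ * X)) : ℝ) : ℂ) =
      (∫ ρ in (1 / 2 : ℝ)..3, Complex.exp (Complex.I * ((t * ρ ^ α + 1 * X * ρ : ℝ) : ℂ)) *
        ((g ρ : ℂ) * a 1 (ρ * X))) +
      ∫ ρ in (1 / 2 : ℝ)..3, Complex.exp (Complex.I * ((t * ρ ^ α + (-1) * X * ρ : ℝ) : ℂ)) *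
        ((g ρ : ℂ) * a (-1) (ρ * X)) := by
    rw [← intervalIntegral.integral_add i1 i2]
    apply intervalIntegral.integral_congr
    intro ρ hρ
    rw [uIcc_of_le (by norm_num)] at hρ
    have hr := hrep (ρ * X) (mul_pos (hpos ρ hρ) hX0)
    have e1 : Complex.exp (Complex.I * ((t * ρ ^ α + 1 * X * ρ : ℝ) : ℂ)) =
        Complex.exp (Complex.I * ((t * ρ ^ α : ℝ) : ℂ)) * Complex.exp (Complex.I * ((ρ * X : ℝ) : ℂ)) := by
      rw [← Complex.exp_add]; congr 1; push_cast; ring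
    have e2 : Complex.exp (Complex.I * ((t * ρ ^ α + (-1) * X * ρ : ℝ) : ℂ)) =
        Complex.exp (Complex.I * ((t * ρ ^ α : ℝ) : ℂ)) *
          Complex.exp (Complex.I * (-((ρ * X : ℝ) : ℂ))) := by
      rw [← Complex.exp_add]; congr 1; push_cast; ring
    simp only [e1, e2, Complex.ofReal_mul (g ρ), hr]
    ring
  rw [this]
  calc _ ≤ _ := (norm_add_le _ _).trans (add_le_add n1 n2)
    _ = _ := by ring

/-! ### Poisson's integral and reduction of the Fourier integral to a radial one. -/

/-- Poisson's integral `∫₀^π cos (r cos θ) sin^k θ dθ` is a Bessel profile. -/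
theorem isBesselProfile_poisson (k : ℕ) :
    IsBesselProfile (((k : ℝ) + 1) / 2)
      (fun r => ∫ θ in (0 : ℝ)..Real.pi, Real.cos (r * Real.cos θ) * Real.sin θ ^ k)
      (fun r => ∫ θ in (0 : ℝ)..Real.pi,
        -Real.sin (r * Real.cos θ) * Real.cos θ * Real.sin θ ^ k) := by
  have hsp : ∀ θ : ℝ, |Real.sin θ ^ k| ≤ 1 := fun θ => by
    rw [abs_pow]; exact pow_le_one₀ (abs_nonneg _) (Real.abs_sin_le_one _)
  have hci : ∀ f : ℝ → ℝ, Continuous f → IntervalIntegrable f volume 0 Real.pi := fun f hf =>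
    hf.intervalIntegrable _ _
  constructor
  · intro r _
    refine (intervalIntegral.hasDerivAt_integral_of_dominated_loc_of_deriv_le (bound := fun _ => 1)
      (F' := fun r θ => -Real.sin (r * Real.cos θ) * Real.cos θ * Real.sin θ ^ k)
      Filter.univ_mem ?_ ?_ ?_ ?_ ?_ ?_).2
    · exact Filter.Eventually.of_forall fun x => Continuous.aestronglyMeasurable (by fun_prop)
    · exact hci _ (by fun_prop)
    · exact Continuous.aestronglyMeasurable (by fun_prop)
    · refine Filter.Eventually.of_forall fun θ _ x _ => ?_
      rw [Real.norm_eq_abs, abs_mul, abs_mul, abs_neg]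
      exact mul_le_one₀ (mul_le_one₀ (Real.abs_sin_le_one _) (abs_nonneg _) (Real.abs_cos_le_one _))
        (abs_nonneg _) (hsp θ)
    · exact hci _ continuous_const
    · refine Filter.Eventually.of_forall fun θ _ x _ => ?_
      exact (((hasDerivAt_mul_const (Real.cos θ)).cos)).mul_const _
  · intro r hr
    have h := (intervalIntegral.hasDerivAt_integral_of_dominated_loc_of_deriv_le (bound := fun _ => 1)
      (μ := volume) (a := 0) (b := Real.pi) (x₀ := r)
      (F := fun r θ => -Real.sin (r * Real.cos θ) * Real.cos θ * Real.sin θ ^ k)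
      (F' := fun r θ => -(Real.cos (r * Real.cos θ) * Real.cos θ) * Real.cos θ * Real.sin θ ^ k)
      Filter.univ_mem
      (Filter.Eventually.of_forall fun x => Continuous.aestronglyMeasurable (by fun_prop))
      (hci _ (by fun_prop)) (Continuous.aestronglyMeasurable (by fun_prop))
      (Filter.Eventually.of_forall fun θ _ x _ => by
        rw [Real.norm_eq_abs, abs_mul, abs_mul, abs_neg, abs_mul]
        exact mul_le_one₀ (mul_le_one₀ (mul_le_one₀ (Real.abs_cos_le_one _) (abs_nonneg _)
          (Real.abs_cos_le_one _)) (abs_nonneg _) (Real.abs_cos_le_one _)) (abs_nonneg _) (hsp θ))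
      (hci _ continuous_const)
      (Filter.Eventually.of_forall fun θ _ x _ =>
        ((((hasDerivAt_mul_const (Real.cos θ)).sin).fun_neg.mul_const _).mul_const _))).2
    refine h.congr_deriv ?_
    -- The derivative of `sin (r cos θ) sin ^ (k + 1) θ` integrates to zero, both boundary terms
    -- containing `sin`. With `sin² = 1 - cos²` the identity is `-r` times the differential
    -- equation.
    have hftc : ∫ θ in (0 : ℝ)..Real.pi, (Real.cos (r * Real.cos θ) * (r * -Real.sin θ) *
        Real.sin θ ^ (k + 1) + Real.sin (r * Real.cos θ) *
          (((k + 1 : ℕ) : ℝ) * Real.sin θ ^ k * Real.cos θ)) = 0 := by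
      rw [intervalIntegral.integral_eq_sub_of_hasDerivAt
        (f := fun θ => Real.sin (r * Real.cos θ) * Real.sin θ ^ (k + 1)) _ (hci _ (by fun_prop))]
      · simp
      · intro θ _
        exact (((Real.hasDerivAt_cos θ).const_mul r).sin).fun_mul ((Real.hasDerivAt_sin θ).fun_pow (k + 1))
    have hlin : ∀ θ : ℝ, Real.cos (r * Real.cos θ) * (r * -Real.sin θ) *
        Real.sin θ ^ (k + 1) + Real.sin (r * Real.cos θ) *
          (((k + 1 : ℕ) : ℝ) * Real.sin θ ^ k * Real.cos θ) =
        -r * (-(Real.cos (r * Real.cos θ) * Real.cos θ) * Real.cos θ * Real.sin θ ^ k) +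
        -r * (Real.cos (r * Real.cos θ) * Real.sin θ ^ k) +
        -((k : ℝ) + 1) * (-Real.sin (r * Real.cos θ) * Real.cos θ * Real.sin θ ^ k) := by
      intro θ
      have := Real.sin_sq_add_cos_sq θ
      push_cast
      linear_combination (-r * Real.cos (r * Real.cos θ) * Real.sin θ ^ k) * this
    simp_rw [hlin] at hftc
    rw [intervalIntegral.integral_add (hci _ (by fun_prop)) (hci _ (by fun_prop)),
      intervalIntegral.integral_add (hci _ (by fun_prop)) (hci _ (by fun_prop)),
      intervalIntegral.integral_const_mul, intervalIntegral.integral_const_mul,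
      intervalIntegral.integral_const_mul] at hftc
    have e : ∀ A : ℝ, r * (2 * (((k : ℝ) + 1) / 2) / r * A) = ((k : ℝ) + 1) * A := fun A => by
      field_simp
    apply mul_left_cancel₀ hr.ne'
    rw [mul_sub, e]
    linear_combination -hftc

/-- Integrals of functions of `⟪x, ξ⟫` and `‖ξ‖`, sliced orthogonally to `x`. -/
theorem integral_inner_norm_eq_integral_prod (n : ℕ) (x : Rd (n + 1)) (F : ℝ → ℝ → ℂ) :
    ∫ ξ : Rd (n + 1), F (inner ℝ x ξ) ‖ξ‖ =
      ∫ p : ℝ × Rd n, F (‖x‖ * p.1) √(p.1 ^ 2 + ‖p.2‖ ^ 2) := by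
  have hfr : Module.finrank ℝ (Rd (n + 1)) = Module.finrank ℝ (WithLp 2 (ℝ × Rd n)) := by
    rw [(WithLp.linearEquiv 2 ℝ (ℝ × Rd n)).finrank_eq]
    simp [add_comm]
  let Φ : Rd (n + 1) ≃ₗᵢ[ℝ] WithLp 2 (ℝ × Rd n) :=
    (stdOrthonormalBasis ℝ (Rd (n + 1))).repr.trans
      ((stdOrthonormalBasis ℝ (WithLp 2 (ℝ × Rd n))).reindex (finCongr hfr.symm)).repr.symm
  set w : WithLp 2 (ℝ × Rd n) := WithLp.toLp 2 (‖x‖, 0) with hw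
  have hwn : ‖Φ x‖ = ‖w‖ := by
    rw [Φ.norm_map, hw, WithLp.prod_norm_eq_of_L2]
    simp
  -- `Φ` is an arbitrary isometry onto the product; reflecting across the hyperplane orthogonal to
  -- `Φ x - w` corrects it so that `x` lands on the first axis.
  set ρ := Submodule.reflection (Submodule.span ℝ {Φ x - w})ᗮ
  have hρ : ρ (Φ x) = w := Submodule.reflection_sub hwn
  let Ψ := Φ.trans ρ
  have hΨ : Ψ x = w := hρ
  have h1 : ∫ ξ : Rd (n + 1), F (inner ℝ x ξ) ‖ξ‖ =
      ∫ y : WithLp 2 (ℝ × Rd n), F (inner ℝ w y) ‖y‖ := by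
    rw [← (Ψ.measurePreserving).integral_comp Ψ.toHomeomorph.measurableEmbedding]
    congr 1
    ext ξ
    rw [← hΨ, Ψ.inner_map_map, Ψ.norm_map]
  rw [h1, ← (WithLp.volume_preserving_toLp ℝ (Rd n)).integral_comp
    (MeasurableEquiv.toLp 2 (ℝ × Rd n)).measurableEmbedding]
  congr 1
  ext p
  rw [hw, WithLp.prod_inner_apply, WithLp.prod_norm_eq_of_L2]
  simp [mul_comm]

/-- The integral over `ℝ^d` of a function of `‖ξ‖` against `cos ⟪x, ξ⟫` reduces to a radial integral
against a Bessel profile. -/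
theorem exists_integral_cos_inner_eq {d : ℕ} (hd : 1 ≤ d) :
    ∃ (c : ℝ) (J J' : ℝ → ℝ), IsBesselProfile (((d : ℝ) - 1) / 2) J J' ∧
      ∀ g : ℝ → ℂ, Continuous g → (∀ ρ, 3 < ρ → g ρ = 0) → ∀ x : Rd d,
        ∫ ξ : Rd d, (Real.cos (inner ℝ x ξ) : ℂ) * g ‖ξ‖ =
          (c : ℂ) * ∫ ρ in Ioi (0 : ℝ), (ρ : ℂ) ^ (d - 1) * (g ρ * (J (ρ * ‖x‖) : ℂ)) := by
  obtain ⟨n, rfl⟩ : ∃ n, d = n + 1 := ⟨d - 1, by omega⟩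
  rcases Nat.eq_zero_or_pos n with rfl | hn
  -- Dimension one is separate: the Poisson integral has weight `sin ^ (d - 2)`, which needs `d ≥
  -- 2`. Here the profile is the cosine itself.
  · refine ⟨(volume : Measure (Rd 1)).real (ball 0 1), Real.cos, fun r => -Real.sin r,
      by simpa using isBesselProfile_cos, fun g _ _ x => ?_⟩
    have h := integral_fun_norm_addHaar (volume : Measure (Rd 1))
      (fun y : ℝ => g y * (Real.cos (y * ‖x‖) : ℂ))
    rw [finrank_euclideanSpace_fin] at h
    have hcos : ∀ ξ : Rd 1, Real.cos (inner ℝ x ξ) = Real.cos (‖ξ‖ * ‖x‖) := fun ξ => by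
      rw [← Real.cos_abs]
      congr 1
      simp [EuclideanSpace.norm_eq, Real.sqrt_sq_eq_abs, PiLp.inner_apply, abs_mul]
    simp_rw [hcos]
    simp only [one_smul, Nat.sub_self, zero_add, pow_zero, one_mul, Complex.real_smul] at h ⊢
    rw [← h]
    congr 1
    ext ξ
    rw [mul_comm]
  obtain ⟨k, rfl⟩ : ∃ k, n = k + 1 := ⟨n - 1, by omega⟩
  have hm : ((((k + 1 + 1 : ℕ) : ℝ)) - 1) / 2 = ((k : ℝ) + 1) / 2 := by push_cast; ring
  refine ⟨((k + 1 : ℕ) : ℝ) * (volume : Measure (Rd (k + 1))).real (ball 0 1), _, _,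
    hm ▸ isBesselProfile_poisson k, fun g hg hg0 x => ?_⟩
  set X := ‖x‖ with hX
  have hpyth : ∀ a b : ℝ, 3 < max |a| |b| → 3 < √(a ^ 2 + b ^ 2) := fun a b h => by
    apply Real.lt_sqrt_of_sq_lt
    rcases lt_max_iff.1 h with h | h <;>
      nlinarith [sq_abs a, sq_abs b, sq_nonneg a, sq_nonneg b]
  rw [integral_inner_norm_eq_integral_prod (k + 1) x (fun a ρ => (Real.cos a : ℂ) * g ρ)]
  have hint1 : Integrable (fun p : ℝ × Rd (k + 1) =>
      (Real.cos (X * p.1) : ℂ) * g √(p.1 ^ 2 + ‖p.2‖ ^ 2)) := by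
    apply Continuous.integrable_of_hasCompactSupport (by fun_prop)
    apply HasCompactSupport.intro (isCompact_closedBall (0 : ℝ × Rd (k + 1)) 3)
    intro p hp
    rw [mem_closedBall_zero_iff, not_le, Prod.norm_def, Real.norm_eq_abs] at hp
    rw [hg0 _ (hpyth _ _ (by rwa [abs_norm])), mul_zero]
  have hint2 : Integrable (fun p : ℝ × ℝ =>
      (p.2 : ℂ) ^ k * ((Real.cos (X * p.1) : ℂ) * g √(p.1 ^ 2 + p.2 ^ 2))) := by
    apply Continuous.integrable_of_hasCompactSupport (by fun_prop)
    apply HasCompactSupport.intro (isCompact_closedBall (0 : ℝ × ℝ) 3)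
    intro p hp
    rw [mem_closedBall_zero_iff, not_le, Prod.norm_def] at hp
    rw [hg0 _ (hpyth _ _ hp), mul_zero, mul_zero]
  -- Polar coordinates in the hyperplane orthogonal to `x`; the constant is the area of its unit
  -- sphere.
  have hslice : ∀ u : ℝ, ∫ v : Rd (k + 1), (Real.cos (X * u) : ℂ) * g √(u ^ 2 + ‖v‖ ^ 2) =
      (((k + 1 : ℕ) : ℝ) * (volume : Measure (Rd (k + 1))).real (ball 0 1) : ℝ) *
        ∫ y in Ioi (0 : ℝ), (y : ℂ) ^ k * ((Real.cos (X * u) : ℂ) * g √(u ^ 2 + y ^ 2)) := by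
    intro u
    have h := integral_fun_norm_addHaar (volume : Measure (Rd (k + 1)))
      (fun y : ℝ => (Real.cos (X * u) : ℂ) * g √(u ^ 2 + y ^ 2))
    rw [finrank_euclideanSpace_fin] at h
    rw [h]
    simp only [nsmul_eq_mul, Complex.real_smul, Nat.add_sub_cancel, Complex.ofReal_pow]
    push_cast
    ring
  set H : ℝ × ℝ → ℂ := fun p =>
    (p.2 : ℂ) ^ k * ((Real.cos (X * p.1) : ℂ) * g √(p.1 ^ 2 + p.2 ^ 2)) with hH
  -- Polar coordinates in the half-plane `y > 0`: the weight `y ^ k` and the Jacobian give `ρ ^ (k +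
  -- 1) sin ^ k θ`, and the angular integral is Poisson's.
  have hpolar : ∫ p in (univ : Set ℝ) ×ˢ Ioi (0 : ℝ), H p =
      ∫ p in Ioi (0 : ℝ) ×ˢ Ioo 0 Real.pi, (p.1 : ℂ) ^ (k + 1) *
        (g p.1 * ((Real.cos (p.1 * X * Real.cos p.2) * Real.sin p.2 ^ k : ℝ) : ℂ)) := by
    have hS : MeasurableSet ((univ : Set ℝ) ×ˢ Ioi (0 : ℝ)) := MeasurableSet.univ.prod measurableSet_Ioi
    have hS' : MeasurableSet ((univ : Set ℝ) ×ˢ Ioo (0 : ℝ) Real.pi) :=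
      MeasurableSet.univ.prod measurableSet_Ioo
    have hset : Ioi (0 : ℝ) ×ˢ Ioo (0 : ℝ) Real.pi =
        polarCoord.target ∩ ((univ : Set ℝ) ×ˢ Ioo (0 : ℝ) Real.pi) := by
      have := Real.pi_pos
      ext ⟨a, b⟩
      simp only [polarCoord_target, mem_prod, mem_Ioi, mem_Ioo, mem_inter_iff, mem_univ, true_and]
      constructor
      · rintro ⟨h1, h2, h3⟩; exact ⟨⟨h1, by linarith, h3⟩, h2, h3⟩
      · rintro ⟨⟨h1, _⟩, h2⟩; exact ⟨h1, h2⟩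
    rw [← integral_indicator hS, ← integral_comp_polarCoord_symm, hset, ← setIntegral_indicator hS']
    apply setIntegral_congr_fun polarCoord.open_target.measurableSet
    rintro ⟨a, b⟩ hp
    simp only [polarCoord_target, mem_prod, mem_Ioi, mem_Ioo] at hp
    obtain ⟨ha, hb1, hb2⟩ := hp
    have hsq : √((a * Real.cos b) ^ 2 + (a * Real.sin b) ^ 2) = a := by
      rw [show (a * Real.cos b) ^ 2 + (a * Real.sin b) ^ 2 = a ^ 2 by
        linear_combination a ^ 2 * Real.sin_sq_add_cos_sq b]
      exact Real.sqrt_sq ha.le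
    by_cases hb : 0 < b
    · have h1 : polarCoord.symm (a, b) ∈ (univ : Set ℝ) ×ˢ Ioi (0 : ℝ) := by
        simpa using mul_pos ha (Real.sin_pos_of_pos_of_lt_pi hb hb2)
      have h2 : (a, b) ∈ (univ : Set ℝ) ×ˢ Ioo (0 : ℝ) Real.pi := ⟨mem_univ _, hb, hb2⟩
      simp only
      rw [indicator_of_mem h1, indicator_of_mem h2]
      simp only [hH, polarCoord_symm_apply, hsq, Complex.real_smul]
      rw [show X * (a * Real.cos b) = a * X * Real.cos b by ring]
      push_cast
      ring
    · have h1 : polarCoord.symm (a, b) ∉ (univ : Set ℝ) ×ˢ Ioi (0 : ℝ) := by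
        have := Real.sin_nonpos_of_nonpos_of_neg_pi_le (not_lt.1 hb) hb1.le
        simpa using mul_nonpos_of_nonneg_of_nonpos ha.le this
      have h2 : (a, b) ∉ (univ : Set ℝ) ×ˢ Ioo (0 : ℝ) Real.pi := fun h => hb h.2.1
      simp only
      rw [indicator_of_notMem h1, indicator_of_notMem h2, smul_zero]
  have hint3 : IntegrableOn (fun p : ℝ × ℝ => (p.1 : ℂ) ^ (k + 1) *
        (g p.1 * ((Real.cos (p.1 * X * Real.cos p.2) * Real.sin p.2 ^ k : ℝ) : ℂ)))
      (Ioi (0 : ℝ) ×ˢ Ioo 0 Real.pi) := by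
    have hc : Continuous (fun p : ℝ × ℝ => (p.1 : ℂ) ^ (k + 1) *
        (g p.1 * ((Real.cos (p.1 * X * Real.cos p.2) * Real.sin p.2 ^ k : ℝ) : ℂ))) := by fun_prop
    have h1 := hc.continuousOn.integrableOn_compact (μ := volume)
      ((isCompact_Icc (a := (0 : ℝ)) (b := 3)).prod (isCompact_Icc (a := (0 : ℝ)) (b := Real.pi)))
    apply h1.of_forall_sdiff_eq_zero (measurableSet_Ioi.prod measurableSet_Ioo)
    rintro ⟨a, b⟩ ⟨⟨ha, hb⟩, hnot⟩
    have : 3 < a := by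
      by_contra h
      exact hnot ⟨⟨le_of_lt ha, not_lt.1 h⟩, hb.1.le, hb.2.le⟩
    simp only
    rw [hg0 a this]; simp
  calc ∫ p : ℝ × Rd (k + 1), (Real.cos (X * p.1) : ℂ) * g √(p.1 ^ 2 + ‖p.2‖ ^ 2)
      = ∫ u : ℝ, ∫ v : Rd (k + 1), (Real.cos (X * u) : ℂ) * g √(u ^ 2 + ‖v‖ ^ 2) :=
        integral_prod _ hint1
    _ = (((k + 1 : ℕ) : ℝ) * (volume : Measure (Rd (k + 1))).real (ball 0 1) : ℝ) *
        ∫ u in (univ : Set ℝ), ∫ y in Ioi (0 : ℝ), H (u, y) := by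
        simp_rw [hslice]
        rw [integral_const_mul, Measure.restrict_univ]
    _ = (((k + 1 : ℕ) : ℝ) * (volume : Measure (Rd (k + 1))).real (ball 0 1) : ℝ) *
        ∫ p in (univ : Set ℝ) ×ˢ Ioi (0 : ℝ), H p := by
        rw [Measure.volume_eq_prod, setIntegral_prod H (hint2.integrableOn)]
    _ = _ := by
        congr 1
        rw [hpolar, Measure.volume_eq_prod, setIntegral_prod _ hint3]
        apply setIntegral_congr_fun measurableSet_Ioi
        intro ρ _
        simp only [Nat.add_sub_cancel]
        rw [integral_const_mul, integral_const_mul, intervalIntegral.integral_of_le Real.pi_pos.le,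
          integral_Ioc_eq_integral_Ioo]
        congr 2
        exact integral_complex_ofReal

/-! ### The frequency-localized kernel and its decay. -/

/-- A smooth cutoff on `ℝ`, equal to `1` on `[1, 4]` and supported in `(1/2, 9/2)`. -/
noncomputable def squaredAnnulusBump : ContDiffBump (5 / 2 : ℝ) := ⟨3 / 2, 2, by norm_num, by norm_num⟩

theorem squaredAnnulusBump_eq_one {r : ℝ} (h1 : 1 ≤ r) (h4 : r ≤ 4) : squaredAnnulusBump r = 1 := by
  apply squaredAnnulusBump.one_of_mem_closedBall
  rw [mem_closedBall, Real.dist_eq, abs_le]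
  change -(3 / 2) ≤ r - 5 / 2 ∧ r - 5 / 2 ≤ 3 / 2
  constructor <;> linarith

theorem squaredAnnulusBump_eq_zero {r : ℝ} (h : r ≤ 1 / 2 ∨ 9 / 2 ≤ r) : squaredAnnulusBump r = 0 := by
  apply squaredAnnulusBump.zero_of_le_dist
  rw [Real.dist_eq, le_abs]
  change 2 ≤ r - 5 / 2 ∨ 2 ≤ -(r - 5 / 2)
  rcases h with h | h
  · right; linarith
  · left; linarith

/-- The kernel of `exp (i t |D| ^ α)` localized to frequencies of size about one. -/
noncomputable def annulusKernel {d : ℕ} (α t : ℝ) (w : Rd d) : ℂ :=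
  ∫ ξ : Rd d, Complex.exp (Complex.I * (inner ℝ w ξ : ℝ)) *
    (Complex.exp (Complex.I * ((t * ‖ξ‖ ^ α : ℝ) : ℂ)) * (squaredAnnulusBump (‖ξ‖ ^ 2) : ℂ))

theorem hasCompactSupport_annulusBump (d : ℕ) :
    HasCompactSupport (fun ξ : Rd d => (squaredAnnulusBump (‖ξ‖ ^ 2) : ℂ)) := by
  apply HasCompactSupport.intro (isCompact_closedBall (0 : Rd d) 3)
  intro ξ hξ
  rw [mem_closedBall_zero_iff, not_le] at hξ
  rw [squaredAnnulusBump_eq_zero (Or.inr (by nlinarith)), Complex.ofReal_zero]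

/-- The dispersive estimate, uniformly in time. -/
theorem exists_norm_annulusKernel_le_rpow {d : ℕ} (hd : 1 ≤ d) {α : ℝ} (hα0 : 0 < α) (hα1 : α < 1) :
    ∃ C : ℝ, 0 ≤ C ∧ ∀ (t : ℝ) (w : Rd d), 1 ≤ ‖w‖ →
      ‖annulusKernel α t w‖ ≤ C * ‖w‖ ^ (-((d : ℝ) / 2)) := by
  obtain ⟨c, J, J', hJ, hrep⟩ := exists_integral_cos_inner_eq hd
  set m : ℝ := ((d : ℝ) - 1) / 2 with hm
  have hχd : ∀ r, HasDerivAt squaredAnnulusBump (deriv squaredAnnulusBump r) r := fun r =>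
    ((squaredAnnulusBump.contDiff (n := 1)).differentiable (by norm_num) r).hasDerivAt
  have hχc : Continuous (deriv squaredAnnulusBump) :=
    (squaredAnnulusBump.contDiff (n := 1)).continuous_deriv (by norm_num)
  -- The weight `ρ ^ (d - 1)` is `ρ ^ m * ρ ^ m`. One factor joins the cutoff, the other forms `(ρ
  -- ‖w‖) ^ m J` at the price of `‖w‖ ^ (-m)`; with the gain `‖w‖ ^ (-1/2)` this makes the exponent
  -- `-d/2`.
  obtain ⟨C, hC0, hC⟩ := hJ.exists_norm_integral_le hα0 hα1
    (g := fun ρ => squaredAnnulusBump (ρ ^ 2) * ρ ^ m)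
    (g' := fun ρ => deriv squaredAnnulusBump (ρ ^ 2) * (2 * ρ) * ρ ^ m +
      squaredAnnulusBump (ρ ^ 2) * (m * ρ ^ (m - 1)))
    (fun x hx => by
      have hx0 : 0 < x := lt_of_lt_of_le (by norm_num) hx.1
      have e1 : HasDerivAt (fun ρ : ℝ => squaredAnnulusBump (ρ ^ 2))
          (deriv squaredAnnulusBump (x ^ 2) * (2 * x)) x := by
        have e0 : HasDerivAt (fun ρ : ℝ => ρ ^ 2) (2 * x) x := by simpa using hasDerivAt_pow 2 x
        exact HasDerivAt.comp (h₂ := squaredAnnulusBump) (h := fun ρ : ℝ => ρ ^ 2) x (hχd (x ^ 2)) e0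
      exact e1.fun_mul (Real.hasDerivAt_rpow_const (Or.inl hx0.ne')))
    (by
      have hx0 : ∀ x ∈ Icc (1 / 2 : ℝ) 3, x ≠ 0 := fun x hx => by
        have := hx.1; intro h; rw [h] at this; norm_num at this
      have r1 : ContinuousOn (fun ρ : ℝ => ρ ^ m) (Icc (1 / 2 : ℝ) 3) :=
        continuousOn_id.rpow_const fun x hx => Or.inl (hx0 x hx)
      have r2 : ContinuousOn (fun ρ : ℝ => ρ ^ (m - 1)) (Icc (1 / 2 : ℝ) 3) :=
        continuousOn_id.rpow_const fun x hx => Or.inl (hx0 x hx)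
      have := squaredAnnulusBump.continuous
      have c1 : Continuous (fun ρ : ℝ => deriv squaredAnnulusBump (ρ ^ 2) * (2 * ρ)) := by fun_prop
      have c2 : Continuous (fun ρ : ℝ => squaredAnnulusBump (ρ ^ 2)) := by fun_prop
      exact (c1.continuousOn.mul r1).add (c2.continuousOn.mul (continuousOn_const.mul r2)))
  refine ⟨|c| * C, by positivity, fun t w hw => ?_⟩
  have hX0 : 0 < ‖w‖ := by linarith
  set g : ℝ → ℂ := fun ρ => Complex.exp (Complex.I * ((t * ρ ^ α : ℝ) : ℂ)) *
    (squaredAnnulusBump (ρ ^ 2) : ℂ) with hg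
  have hgc : Continuous g := by
    have := Real.continuous_rpow_const hα0.le
    have := squaredAnnulusBump.continuous
    fun_prop
  have hg0 : ∀ ρ, 3 < ρ → g ρ = 0 := fun ρ hρ => by
    simp only [hg]; rw [squaredAnnulusBump_eq_zero (Or.inr (by nlinarith))]; simp
  have hcs : HasCompactSupport (fun ξ : Rd d => g ‖ξ‖) := (hasCompactSupport_annulusBump d).mul_left
  have hi1 : Integrable (fun ξ : Rd d => (Real.cos (inner ℝ w ξ) : ℂ) * g ‖ξ‖) :=
    Continuous.integrable_of_hasCompactSupport (by fun_prop) hcs.mul_left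
  have hi2 : Integrable (fun ξ : Rd d => (Real.sin (inner ℝ w ξ) : ℂ) * g ‖ξ‖) :=
    Continuous.integrable_of_hasCompactSupport (by fun_prop) hcs.mul_left
  -- The amplitude is radial, so only the even part of the plane wave survives.
  have hodd : ∫ ξ : Rd d, (Real.sin (inner ℝ w ξ) : ℂ) * g ‖ξ‖ = 0 := by
    have h := integral_neg_eq_self (fun ξ : Rd d => (Real.sin (inner ℝ w ξ) : ℂ) * g ‖ξ‖) volume
    simp only [inner_neg_right, Real.sin_neg, norm_neg, Complex.ofReal_neg, neg_mul] at h
    rw [integral_neg] at h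
    exact self_eq_neg.1 h.symm
  have hcosK : annulusKernel α t w = ∫ ξ : Rd d, (Real.cos (inner ℝ w ξ) : ℂ) * g ‖ξ‖ := by
    have : ∀ ξ : Rd d, Complex.exp (Complex.I * (inner ℝ w ξ : ℝ)) *
        (Complex.exp (Complex.I * ((t * ‖ξ‖ ^ α : ℝ) : ℂ)) * (squaredAnnulusBump (‖ξ‖ ^ 2) : ℂ)) =
        (Real.cos (inner ℝ w ξ) : ℂ) * g ‖ξ‖ + Complex.I * ((Real.sin (inner ℝ w ξ) : ℂ) * g ‖ξ‖) := by
      intro ξ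
      rw [mul_comm Complex.I (inner ℝ w ξ : ℝ), Complex.exp_mul_I]
      simp only [hg]
      push_cast
      ring
    rw [annulusKernel]
    simp_rw [this]
    rw [integral_add hi1 (hi2.const_mul _), integral_const_mul, hodd, mul_zero, add_zero]
  have hrad : ∫ ρ in Ioi (0 : ℝ), (ρ : ℂ) ^ (d - 1) * (g ρ * (J (ρ * ‖w‖) : ℂ)) =
      ((‖w‖ ^ (-m) : ℝ) : ℂ) * ∫ ρ in (1 / 2 : ℝ)..3, Complex.exp (Complex.I * ((t * ρ ^ α : ℝ) : ℂ)) *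
        ((squaredAnnulusBump (ρ ^ 2) * ρ ^ m * ((ρ * ‖w‖) ^ m * J (ρ * ‖w‖)) : ℝ) : ℂ) := by
    rw [intervalIntegral.integral_of_le (by norm_num), ← integral_const_mul]
    have hsub : Ioc (1 / 2 : ℝ) 3 ⊆ Ioi 0 := fun x hx => lt_trans (by norm_num) hx.1
    rw [setIntegral_eq_of_subset_of_forall_sdiff_eq_zero measurableSet_Ioi hsub]
    · apply setIntegral_congr_fun measurableSet_Ioc
      intro ρ hρ
      have hρ0 : 0 < ρ := hsub hρ
      have e1 : ρ ^ (d - 1) = ρ ^ m * ρ ^ m := by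
        rw [← Real.rpow_add hρ0, ← Real.rpow_natCast]
        congr 1
        rw [Nat.cast_sub hd, hm]; push_cast; ring
      have e2 : ‖w‖ ^ (-m) * ‖w‖ ^ m = 1 := by
        rw [← Real.rpow_add hX0]; simp
      have e3 : (ρ : ℂ) ^ (d - 1) = ((ρ ^ m * ρ ^ m : ℝ) : ℂ) := by rw [← e1]; push_cast; rfl
      have e4 : ((‖w‖ ^ (-m) : ℝ) : ℂ) * ((‖w‖ ^ m : ℝ) : ℂ) = 1 := by exact_mod_cast e2
      simp only [hg]
      rw [e3, Real.mul_rpow hρ0.le hX0.le]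
      push_cast at e4 ⊢
      linear_combination (-Complex.exp (Complex.I * (t * ((ρ ^ α : ℝ) : ℂ))) *
        (squaredAnnulusBump (ρ ^ 2) : ℂ) * ((ρ ^ m : ℝ) : ℂ) ^ 2 * J (ρ * ‖w‖)) * e4
    · intro ρ hρ
      have : ρ ^ 2 ≤ 1 / 2 ∨ 9 / 2 ≤ ρ ^ 2 := by
        have h0 : 0 < ρ := hρ.1
        rcases le_or_gt ρ (1 / 2) with h | h
        · left; nlinarith
        · right
          have : 3 < ρ := by
            by_contra h3; exact hρ.2 ⟨h, not_lt.1 h3⟩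
          nlinarith
      simp only [hg]
      rw [squaredAnnulusBump_eq_zero this]; simp
  rw [hcosK, hrep g hgc hg0 w, hrad, norm_mul, norm_mul, Complex.norm_real, Complex.norm_real,
    Real.norm_eq_abs, Real.norm_eq_abs, abs_of_pos (Real.rpow_pos_of_pos hX0 _)]
  have hfin : ‖w‖ ^ (-((d : ℝ) / 2)) = ‖w‖ ^ (-m) * (1 / √‖w‖) := by
    rw [Real.sqrt_eq_rpow, one_div, ← Real.rpow_neg hX0.le, ← Real.rpow_add hX0]
    congr 1; rw [hm]; ring
  rw [hfin]
  calc |c| * (‖w‖ ^ (-m) * _) ≤ |c| * (‖w‖ ^ (-m) * (C / √‖w‖)) := by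
        gcongr
        exact hC t ‖w‖ hw
    _ = _ := by ring

/-- Decay in a fixed direction of the Fourier transform of `exp (i t φ) a`, by repeated integration
by parts; every integration costs at most one factor `1 + |t|`. -/
theorem exists_inner_pow_mul_norm_integral_le {d : ℕ} {φ : Rd d → ℝ} (hφ : ContDiff ℝ ∞ φ) (v : Rd d)
    (N : ℕ) : ∀ a : Rd d → ℂ, ContDiff ℝ ∞ a → HasCompactSupport a →
    ∃ C : ℝ, 0 ≤ C ∧ ∀ (t : ℝ) (w : Rd d),
      |inner ℝ w v| ^ N * ‖∫ ξ, Complex.exp (Complex.I * (inner ℝ w ξ : ℝ)) *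
        (Complex.exp (Complex.I * ((t * φ ξ : ℝ) : ℂ)) * a ξ)‖ ≤ C * (1 + |t|) ^ N := by
  have hnexp : ∀ r : ℝ, ‖Complex.exp (Complex.I * (r : ℂ))‖ = 1 := fun r => by
    rw [mul_comm]; exact Complex.norm_exp_ofReal_mul_I r
  -- The amplitude is quantified inside the induction: a derivative along `v` falls on `a` or on the
  -- phase, the latter producing `t` times the new amplitude `i (∂_v φ) a`, again smooth and
  -- compactly supported.
  induction N with
  | zero =>
    intro a ha hca
    refine ⟨∫ ξ, ‖a ξ‖, integral_nonneg fun _ => norm_nonneg _, fun t w => ?_⟩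
    rw [pow_zero, pow_zero, one_mul, mul_one]
    refine (norm_integral_le_integral_norm _).trans (le_of_eq ?_)
    congr 1
    ext ξ
    rw [norm_mul, norm_mul, hnexp, hnexp, one_mul, one_mul]
  | succ N ih =>
    intro a ha hca
    have ha1 : ContDiff ℝ ∞ (fun ξ => fderiv ℝ a ξ v) :=
      (ha.fderiv_right (m := ∞) (by simp)).clm_apply contDiff_const
    have hφ1 : ContDiff ℝ ∞ (fun ξ => fderiv ℝ φ ξ v) :=
      (hφ.fderiv_right (m := ∞) (by simp)).clm_apply contDiff_const
    have ha2 : ContDiff ℝ ∞ (fun ξ => Complex.I * ((fderiv ℝ φ ξ v : ℝ) : ℂ) * a ξ) :=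
      (contDiff_const.mul (Complex.ofRealCLM.contDiff.comp hφ1)).mul ha
    have hc1 : HasCompactSupport (fun ξ => fderiv ℝ a ξ v) := hca.fderiv_apply ℝ v
    have hc2 : HasCompactSupport (fun ξ => Complex.I * ((fderiv ℝ φ ξ v : ℝ) : ℂ) * a ξ) := hca.mul_left
    obtain ⟨C1, hC1, h1⟩ := ih _ ha1 hc1
    obtain ⟨C2, hC2, h2⟩ := ih _ ha2 hc2
    refine ⟨C1 + C2, by positivity, fun t w => ?_⟩
    have hφd : Differentiable ℝ φ := hφ.differentiable (by simp)
    have had : Differentiable ℝ a := ha.differentiable (by simp)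
    set e : Rd d → ℂ := fun ξ => Complex.exp (Complex.I * (inner ℝ w ξ : ℝ)) with he
    set p : Rd d → ℂ := fun ξ => Complex.exp (Complex.I * ((t * φ ξ : ℝ) : ℂ)) with hp
    have hce : Continuous e := by fun_prop
    have hφc := hφ.continuous
    have hac := ha.continuous
    have hcp : Continuous p := by fun_prop
    have hde : ∀ ξ, HasFDerivAt e (e ξ • (Complex.I • Complex.ofRealCLM.comp (innerSL ℝ w))) ξ := by
      intro ξ
      have := (((Complex.ofRealCLM.comp (innerSL ℝ w)).hasFDerivAt (x := ξ)).const_mul Complex.I).cexp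
      exact this
    have hdp : ∀ ξ, HasFDerivAt p (p ξ • (Complex.I • Complex.ofRealCLM.comp (t • fderiv ℝ φ ξ))) ξ := by
      intro ξ
      have := ((Complex.ofRealCLM.hasFDerivAt.comp ξ
        ((hφd ξ).hasFDerivAt.const_mul t)).const_mul Complex.I).cexp
      exact this
    have hdg : ∀ ξ, HasFDerivAt (fun ξ => p ξ * a ξ)
        (p ξ • fderiv ℝ a ξ + a ξ • (p ξ • (Complex.I • Complex.ofRealCLM.comp (t • fderiv ℝ φ ξ)))) ξ :=
      fun ξ => (hdp ξ).mul (had ξ).hasFDerivAt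
    have he' : ∀ ξ, fderiv ℝ e ξ v = Complex.I * (inner ℝ w v : ℝ) * e ξ := fun ξ => by
      rw [(hde ξ).fderiv]; simp; ring
    have hg' : ∀ ξ, fderiv ℝ (fun ξ => p ξ * a ξ) ξ v =
        p ξ * fderiv ℝ a ξ v + (t : ℂ) * (p ξ * (Complex.I * ((fderiv ℝ φ ξ v : ℝ) : ℂ) * a ξ)) :=
      fun ξ => by rw [(hdg ξ).fderiv]; simp; ring
    have hca1 : Continuous (fun ξ => fderiv ℝ a ξ v) := ha1.continuous
    have hca2 := ha2.continuous
    have i1 : Integrable (fun ξ => e ξ * (p ξ * fderiv ℝ a ξ v)) :=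
      Continuous.integrable_of_hasCompactSupport (by fun_prop) hc1.mul_left.mul_left
    have i2 : Integrable (fun ξ => e ξ * (p ξ * (Complex.I * ((fderiv ℝ φ ξ v : ℝ) : ℂ) * a ξ))) :=
      (hce.mul (hcp.mul hca2)).integrable_of_hasCompactSupport hc2.mul_left.mul_left
    have i0 : Integrable (fun ξ => e ξ * (p ξ * a ξ)) :=
      Continuous.integrable_of_hasCompactSupport (by fun_prop) hca.mul_left.mul_left
    have hsplit : ∀ ξ, e ξ * fderiv ℝ (fun ξ => p ξ * a ξ) ξ v = e ξ * (p ξ * fderiv ℝ a ξ v) +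
        (t : ℂ) * (e ξ * (p ξ * (Complex.I * ((fderiv ℝ φ ξ v : ℝ) : ℂ) * a ξ))) := fun ξ => by
      rw [hg']; ring
    have hparts := integral_mul_fderiv_eq_neg_fderiv_mul_of_integrable (μ := (volume : Measure (Rd d)))
      (f := e) (g := fun ξ => p ξ * a ξ) (v := v)
      (by
        simp_rw [he']
        exact (i0.const_mul (Complex.I * (inner ℝ w v : ℝ))).congr
          (Filter.Eventually.of_forall fun ξ => by simp only; ring))
      (by simp_rw [hsplit]; exact i1.add (i2.const_mul _))
      i0 (fun ξ _ => (hde ξ).differentiableAt) (fun ξ _ => (hdg ξ).differentiableAt)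
    simp_rw [hsplit, he'] at hparts
    rw [integral_add i1 (i2.const_mul _), integral_const_mul] at hparts
    simp_rw [mul_assoc (Complex.I * _)] at hparts
    rw [integral_const_mul] at hparts
    have hnorm : |inner ℝ w v| * ‖∫ ξ, e ξ * (p ξ * a ξ)‖ ≤ ‖∫ ξ, e ξ * (p ξ * fderiv ℝ a ξ v)‖ +
        |t| * ‖∫ ξ, e ξ * (p ξ * (Complex.I * ((fderiv ℝ φ ξ v : ℝ) : ℂ) * a ξ))‖ := by
      have := congrArg norm hparts
      rw [norm_neg, norm_mul, norm_mul, Complex.norm_I, one_mul, Complex.norm_real,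
        Real.norm_eq_abs] at this
      rw [← this]
      refine (norm_add_le _ _).trans ?_
      rw [norm_mul, Complex.norm_real, Real.norm_eq_abs]
    have k1 := h1 t w
    have k2 := h2 t w
    calc |inner ℝ w v| ^ (N + 1) * ‖∫ ξ, e ξ * (p ξ * a ξ)‖
        = |inner ℝ w v| ^ N * (|inner ℝ w v| * ‖∫ ξ, e ξ * (p ξ * a ξ)‖) := by ring
      _ ≤ |inner ℝ w v| ^ N * (‖∫ ξ, e ξ * (p ξ * fderiv ℝ a ξ v)‖ +
        |t| * ‖∫ ξ, e ξ * (p ξ * (Complex.I * ((fderiv ℝ φ ξ v : ℝ) : ℂ) * a ξ))‖) := by gcongr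
      _ = |inner ℝ w v| ^ N * ‖∫ ξ, e ξ * (p ξ * fderiv ℝ a ξ v)‖ +
        |t| * (|inner ℝ w v| ^ N *
          ‖∫ ξ, e ξ * (p ξ * (Complex.I * ((fderiv ℝ φ ξ v : ℝ) : ℂ) * a ξ))‖) := by ring
      _ ≤ C1 * (1 + |t|) ^ N + |t| * (C2 * (1 + |t|) ^ N) := by gcongr
      _ ≤ (C1 + C2) * (1 + |t|) ^ (N + 1) := by
        rw [pow_succ]
        have : 0 ≤ C1 * (|t| * (1 + |t|) ^ N) := by positivity
        have : 0 ≤ C2 * (1 + |t|) ^ N := by positivity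
        linarith

/-- A smooth function agreeing with `ξ ↦ ‖ξ‖ ^ α` for `‖ξ‖² ≥ 1/2`. -/
theorem exists_contDiff_eq_norm_rpow (d : ℕ) (α : ℝ) :
    ∃ φ : Rd d → ℝ, ContDiff ℝ ∞ φ ∧ ∀ ξ, 1 / 2 ≤ ‖ξ‖ ^ 2 → φ ξ = ‖ξ‖ ^ α := by
  set s : ℝ → ℝ := fun r => Real.smoothTransition (4 * r - 1) with hs
  have hsc : ContDiff ℝ ∞ s :=
    Real.smoothTransition.contDiff.comp ((contDiff_const.mul contDiff_id).sub contDiff_const)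
  -- `q` interpolates between `1` near the origin and `r` for `r ≥ 1/2`. It stays positive, so its
  -- real powers are smooth.
  set q : ℝ → ℝ := fun r => r * s r + (1 - s r) with hq
  have hqc : ContDiff ℝ ∞ q := (contDiff_id.mul hsc).add (contDiff_const.sub hsc)
  have hqpos : ∀ r, 0 < q r := by
    intro r
    have h0 : 0 ≤ s r := Real.smoothTransition.nonneg _
    have h1 : s r ≤ 1 := Real.smoothTransition.le_one _
    rcases le_or_gt r (1 / 4) with h | h
    · have : s r = 0 := Real.smoothTransition.zero_of_nonpos (by linarith)
      simp only [hq]; rw [this]; norm_num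
    · simp only [hq]; nlinarith
  refine ⟨fun ξ => q (‖ξ‖ ^ 2) ^ (α / 2),
    (hqc.comp (contDiff_norm_sq ℝ)).rpow_const_of_ne fun ξ => (hqpos _).ne', fun ξ hξ => ?_⟩
  have : s (‖ξ‖ ^ 2) = 1 := Real.smoothTransition.one_of_one_le (by linarith)
  simp only [hq, this, mul_one, sub_self, add_zero]
  rw [← Real.rpow_natCast, ← Real.rpow_mul (norm_nonneg _)]
  congr 1; push_cast; ring

/-- The norm is at most the sum of the absolute coordinates, so some coordinate reaches the average
`‖w‖ / d`. This converts decay along coordinate directions into decay in `‖w‖`. -/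
theorem exists_norm_le_card_mul_abs_coord {d : ℕ} (hd : 1 ≤ d) (w : Rd d) :
    ∃ j : Fin d, ‖w‖ ≤ d * |inner ℝ w (EuclideanSpace.single j (1 : ℝ))| := by
  have hd0 : (0 : ℝ) < d := by exact_mod_cast hd
  have hsum : ∑ _j : Fin d, ‖w‖ / d ≤ ∑ j : Fin d, |inner ℝ w (EuclideanSpace.single j (1 : ℝ))| := by
    rw [Finset.sum_const, Finset.card_univ, Fintype.card_fin, nsmul_eq_mul,
      mul_div_cancel₀ _ hd0.ne']
    have h := (EuclideanSpace.basisFun (Fin d) ℝ).sum_repr w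
    calc ‖w‖ = ‖∑ j, (EuclideanSpace.basisFun (Fin d) ℝ).repr w j •
          EuclideanSpace.basisFun (Fin d) ℝ j‖ := by rw [h]
      _ ≤ ∑ j, ‖(EuclideanSpace.basisFun (Fin d) ℝ).repr w j •
          EuclideanSpace.basisFun (Fin d) ℝ j‖ := norm_sum_le _ _
      _ = _ := by
        apply Finset.sum_congr rfl
        intro j _
        simp [norm_smul, EuclideanSpace.inner_single_right]
  have : Nonempty (Fin d) := ⟨⟨0, hd⟩⟩
  obtain ⟨j, _, hj⟩ := Finset.exists_le_of_sum_le Finset.univ_nonempty hsum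
  exact ⟨j, by rwa [div_le_iff₀' hd0] at hj⟩

/-- Rapid decay of the kernel outside the light cone. -/
theorem exists_norm_pow_mul_norm_annulusKernel_le {d : ℕ} (hd : 1 ≤ d) (α : ℝ) (N : ℕ) :
    ∃ C : ℝ, 0 ≤ C ∧ ∀ (t : ℝ) (w : Rd d),
      ‖w‖ ^ N * ‖annulusKernel α t w‖ ≤ C * (1 + |t|) ^ N := by
  obtain ⟨φ, hφ, hφα⟩ := exists_contDiff_eq_norm_rpow d α
  -- Evaluating the cutoff at `‖ξ‖ ^ 2` rather than `‖ξ‖` makes smoothness at the origin automatic.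
  have hbc : ContDiff ℝ ∞ (fun ξ : Rd d => (squaredAnnulusBump (‖ξ‖ ^ 2) : ℂ)) :=
    Complex.ofRealCLM.contDiff.comp (squaredAnnulusBump.contDiff.comp (contDiff_norm_sq ℝ))
  -- The cutoff vanishes wherever the smooth phase might differ from `‖ξ‖ ^ α`.
  have hK : ∀ (t : ℝ) (w : Rd d), annulusKernel α t w =
      ∫ ξ, Complex.exp (Complex.I * (inner ℝ w ξ : ℝ)) *
        (Complex.exp (Complex.I * ((t * φ ξ : ℝ) : ℂ)) * (squaredAnnulusBump (‖ξ‖ ^ 2) : ℂ)) := by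
    intro t w
    unfold annulusKernel
    congr 1
    ext ξ
    rcases le_or_gt (1 / 2) (‖ξ‖ ^ 2) with h | h
    · rw [hφα ξ h]
    · rw [squaredAnnulusBump_eq_zero (Or.inl h.le)]; simp
  choose C hC0 hC using fun j : Fin d => exists_inner_pow_mul_norm_integral_le hφ
    (EuclideanSpace.single j (1 : ℝ)) N _ hbc (hasCompactSupport_annulusBump d)
  refine ⟨(d : ℝ) ^ N * ∑ j, C j,
    mul_nonneg (by positivity) (Finset.sum_nonneg fun j _ => hC0 j), fun t w => ?_⟩
  obtain ⟨j, hj⟩ := exists_norm_le_card_mul_abs_coord hd w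
  have h1 := hC j t w
  rw [← hK] at h1
  calc ‖w‖ ^ N * ‖annulusKernel α t w‖
      ≤ (d * |inner ℝ w (EuclideanSpace.single j (1 : ℝ))|) ^ N * ‖annulusKernel α t w‖ := by gcongr
    _ = (d : ℝ) ^ N *
        (|inner ℝ w (EuclideanSpace.single j (1 : ℝ))| ^ N * ‖annulusKernel α t w‖) := by ring
    _ ≤ (d : ℝ) ^ N * (C j * (1 + |t|) ^ N) := by gcongr
    _ ≤ (d : ℝ) ^ N * ((∑ j, C j) * (1 + |t|) ^ N) := by
      gcongr
      exact Finset.single_le_sum (f := C) (fun i _ => hC0 i) (Finset.mem_univ j)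
    _ = _ := by ring

/-! ### Weighted kernel bounds on bounded ranges of time. -/

theorem one_add_rpow_le_two_rpow_mul {p ρ : ℝ} (hp : 0 ≤ p) (hρ : 1 ≤ ρ) :
    (1 + ρ) ^ p ≤ 2 ^ p * ρ ^ p := by
  rw [← Real.mul_rpow (by norm_num) (by linarith)]
  exact Real.rpow_le_rpow (by linarith) (by linarith) hp

theorem one_add_rpow_le_two_rpow {p ρ : ℝ} (hp : 0 ≤ p) (h0 : 0 ≤ ρ) (hρ : ρ ≤ 1) :
    (1 + ρ) ^ p ≤ 2 ^ p :=
  Real.rpow_le_rpow (by linarith) (by linarith) hp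

/-- Kernel bound for bounded times. -/
theorem exists_norm_annulusKernel_le_of_abs_le_one {d : ℕ} (hd : 1 ≤ d) (α : ℝ) {p : ℝ} (hp : 0 ≤ p) :
    ∃ C : ℝ, 0 ≤ C ∧ ∀ (t : ℝ) (w : Rd d), |t| ≤ 1 →
      ‖annulusKernel α t w‖ * (1 + ‖w‖) ^ p ≤ C := by
  obtain ⟨C0, hC0, h0⟩ := exists_norm_pow_mul_norm_annulusKernel_le hd α 0
  obtain ⟨C1, hC1, h1⟩ := exists_norm_pow_mul_norm_annulusKernel_le hd α ⌈p⌉₊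
  refine ⟨2 ^ p * (C0 + C1 * 2 ^ ⌈p⌉₊), by positivity, fun t w ht => ?_⟩
  have k0 : ‖annulusKernel α t w‖ ≤ C0 := by simpa using h0 t w
  rcases le_or_gt ‖w‖ 1 with hw | hw
  · calc _ ≤ C0 * 2 ^ p :=
        mul_le_mul k0 (one_add_rpow_le_two_rpow hp (norm_nonneg _) hw) (by positivity) hC0
      _ ≤ _ := by
        have : 0 ≤ (2 : ℝ) ^ p * (C1 * 2 ^ ⌈p⌉₊) := by positivity
        linarith
  · have k1 : ‖w‖ ^ p ≤ ‖w‖ ^ ⌈p⌉₊ := by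
      rw [← Real.rpow_natCast]; exact Real.rpow_le_rpow_of_exponent_le hw.le (Nat.le_ceil p)
    calc _ ≤ ‖annulusKernel α t w‖ * (2 ^ p * ‖w‖ ^ ⌈p⌉₊) := by
          gcongr
          exact (one_add_rpow_le_two_rpow_mul hp hw.le).trans (by gcongr)
      _ = 2 ^ p * (‖w‖ ^ ⌈p⌉₊ * ‖annulusKernel α t w‖) := by ring
      _ ≤ 2 ^ p * (C1 * (1 + |t|) ^ ⌈p⌉₊) :=
        mul_le_mul_of_nonneg_left (h1 t w) (by positivity)
      _ ≤ 2 ^ p * (C1 * 2 ^ ⌈p⌉₊) := by gcongr; linarith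
      _ ≤ _ := by gcongr; linarith

/-- Kernel bound for times up to `T`, with a loss of a power of `T`. -/
theorem exists_norm_annulusKernel_le_of_abs_le {d : ℕ} (hd : 1 ≤ d) {α : ℝ} (hα0 : 0 < α) (hα1 : α < 1)
    {p σ δ : ℝ} (hp : 0 ≤ p) (hσ : 0 < σ) (hδ : 0 < δ) (hpσ : p - (d : ℝ) / 2 + δ ≤ σ) :
    ∃ C : ℝ, 0 ≤ C ∧ ∀ (T t : ℝ) (w : Rd d), 1 ≤ T → |t| ≤ T →
      ‖annulusKernel α t w‖ * (1 + ‖w‖) ^ p ≤ C * T ^ σ := by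
  -- `κ` exceeds `1`, yet `κ (σ - δ) = σ - δ ^ 2 / σ ≤ σ`: the dispersive bound can be used up to
  -- `‖w‖ = T ^ κ`, slightly beyond the light cone, within the budget `T ^ σ`.
  set κ := 1 + δ / σ with hκ
  have hκ1 : 0 < κ - 1 := by rw [hκ, add_sub_cancel_left]; positivity
  -- Large enough that `N + κ (p - N) ≤ 0`, so beyond `T ^ κ` the rapid decay compensates the factor
  -- `T ^ N`.
  set N := ⌈κ * p / (κ - 1)⌉₊ with hN
  obtain ⟨C0, hC0, h0⟩ := exists_norm_pow_mul_norm_annulusKernel_le hd α 0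
  obtain ⟨C1, hC1, h1⟩ := exists_norm_annulusKernel_le_rpow hd hα0 hα1
  obtain ⟨C2, hC2, h2⟩ := exists_norm_pow_mul_norm_annulusKernel_le hd α N
  refine ⟨2 ^ p * (C0 + C1 + C2 * 2 ^ N), by positivity, fun T t w hT ht => ?_⟩
  have hT0 : 0 < T := by linarith
  have hTσ : 1 ≤ T ^ σ := Real.one_le_rpow hT hσ.le
  have k0 : ‖annulusKernel α t w‖ ≤ C0 := by simpa using h0 t w
  rcases le_or_gt ‖w‖ 1 with hw | hw
  · calc _ ≤ C0 * 2 ^ p :=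
        mul_le_mul k0 (one_add_rpow_le_two_rpow hp (norm_nonneg _) hw) (by positivity) hC0
      _ = 2 ^ p * C0 * 1 := by ring
      _ ≤ 2 ^ p * (C0 + C1 + C2 * 2 ^ N) * T ^ σ := by
        gcongr
        have : 0 ≤ C2 * 2 ^ N := by positivity
        linarith
  have hw0 : 0 < ‖w‖ := by linarith
  have hmain := one_add_rpow_le_two_rpow_mul hp hw.le
  rcases le_or_gt ‖w‖ (T ^ κ) with hwT | hwT
  · have e1 : ‖w‖ ^ (-((d : ℝ) / 2)) * ‖w‖ ^ p ≤ T ^ σ := by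
      rw [← Real.rpow_add hw0]
      calc ‖w‖ ^ (-((d : ℝ) / 2) + p) ≤ ‖w‖ ^ (max 0 (σ - δ)) :=
            Real.rpow_le_rpow_of_exponent_le hw.le (le_max_of_le_right (by linarith))
        _ ≤ (T ^ κ) ^ (max 0 (σ - δ)) :=
            Real.rpow_le_rpow hw0.le hwT (le_max_left _ _)
        _ = T ^ (κ * max 0 (σ - δ)) := (Real.rpow_mul hT0.le _ _).symm
        _ ≤ T ^ σ := by
            apply Real.rpow_le_rpow_of_exponent_le hT
            rcases max_cases 0 (σ - δ) with ⟨h, _⟩ | ⟨h, _⟩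
            · rw [h, mul_zero]; exact hσ.le
            · rw [h, hκ]
              have : (1 + δ / σ) * (σ - δ) = σ - δ ^ 2 / σ := by field_simp; ring
              rw [this]
              have : 0 ≤ δ ^ 2 / σ := by positivity
              linarith
    calc _ ≤ (C1 * ‖w‖ ^ (-((d : ℝ) / 2))) * (2 ^ p * ‖w‖ ^ p) := by
          gcongr
          exact h1 t w hw.le
      _ = 2 ^ p * C1 * (‖w‖ ^ (-((d : ℝ) / 2)) * ‖w‖ ^ p) := by ring
      _ ≤ 2 ^ p * (C0 + C1 + C2 * 2 ^ N) * T ^ σ := by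
        gcongr
        have : 0 ≤ C2 * 2 ^ N := by positivity
        linarith
  · have hNle : κ * p ≤ N * (κ - 1) := by
      have := Nat.le_ceil (κ * p / (κ - 1))
      rwa [div_le_iff₀ hκ1] at this
    have hpN : p - N ≤ 0 := by
      have hκ0 : 0 < κ := by linarith
      have : κ * p ≤ κ * N := by
        have : (0 : ℝ) ≤ N := Nat.cast_nonneg _
        linarith
      linarith [le_of_mul_le_mul_left this hκ0]
    have e1 : T ^ N * ‖w‖ ^ (p - N) ≤ T ^ σ := by
      calc T ^ N * ‖w‖ ^ (p - N) ≤ T ^ N * (T ^ κ) ^ (p - N) :=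
            mul_le_mul_of_nonneg_left
              (Real.rpow_le_rpow_of_nonpos (by positivity) hwT.le hpN) (by positivity)
        _ = T ^ (N + κ * (p - N)) := by
            rw [← Real.rpow_mul hT0.le, ← Real.rpow_natCast, ← Real.rpow_add hT0]
        _ ≤ T ^ (0 : ℝ) := Real.rpow_le_rpow_of_exponent_le hT (by linarith)
        _ ≤ T ^ σ := by rw [Real.rpow_zero]; exact hTσ
    have e2 : ‖w‖ ^ p = ‖w‖ ^ N * ‖w‖ ^ (p - N) := by
      rw [← Real.rpow_natCast, ← Real.rpow_add hw0]; congr 1; ring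
    calc _ ≤ ‖annulusKernel α t w‖ * (2 ^ p * ‖w‖ ^ p) := by gcongr
      _ = 2 ^ p * (‖w‖ ^ N * ‖annulusKernel α t w‖) * ‖w‖ ^ (p - N) := by rw [e2]; ring
      _ ≤ 2 ^ p * (C2 * (1 + |t|) ^ N) * ‖w‖ ^ (p - N) :=
        mul_le_mul_of_nonneg_right (mul_le_mul_of_nonneg_left (h2 t w) (by positivity)) (by positivity)
      _ ≤ 2 ^ p * (C2 * (2 * T) ^ N) * ‖w‖ ^ (p - N) := by gcongr; linarith
      _ = 2 ^ p * (C2 * 2 ^ N) * (T ^ N * ‖w‖ ^ (p - N)) := by rw [mul_pow]; ring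
      _ ≤ 2 ^ p * (C0 + C1 + C2 * 2 ^ N) * T ^ σ := by
        gcongr
        linarith

/-! ### Integrals against `γ`-dimensional measures. -/

/-- The infimum defining `dimConst` is attained. -/
theorem isBallBound_dimConst {d : ℕ} {γ : ℝ} {μ : Measure (Rd d)} (h : IsGammaDimensional γ μ) :
    IsBallBound γ μ (dimConst γ μ) := by
  intro x r hr
  have hcont : Continuous (fun C : ℝ => ENNReal.ofReal (C * r ^ γ)) :=
    ENNReal.continuous_ofReal.comp (continuous_mul_const _)
  refine ge_of_tendsto ((hcont.tendsto _).mono_left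
    (nhdsWithin_le_nhds (s := Ioi (dimConst γ μ : ℝ)))) ?_
  filter_upwards [self_mem_nhdsWithin] with C hC
  have hC0 : 0 ≤ C := le_trans (NNReal.coe_nonneg _) (le_of_lt hC)
  have hlt : sInf {C : ℝ≥0 | IsBallBound γ μ C} < ⟨C, hC0⟩ := hC
  obtain ⟨D, hD, hDC⟩ := exists_lt_of_csInf_lt h hlt
  refine (hD x r hr).trans (ENNReal.ofReal_le_ofReal ?_)
  have : (D : ℝ) < C := hDC
  gcongr

/-- Schur-type bound for a `γ`-dimensional measure, by dyadic decomposition. -/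
theorem exists_lintegral_one_add_rpow_le {γ p : ℝ} (hp : 0 ≤ p) (hγp : γ < p) :
    ∃ A : ℝ, 0 ≤ A ∧ ∀ {d : ℕ} (μ : Measure (Rd d)) (C : ℝ≥0), IsBallBound γ μ C →
      ∀ R : ℝ, 0 < R → ∀ x : Rd d,
        ∫⁻ y, ENNReal.ofReal ((1 + R * ‖x - y‖) ^ (-p)) ∂μ ≤ ENNReal.ofReal (A * (C * R ^ (-γ))) := by
  -- Ratio of the dyadic series: passing from `2 ^ k / R` to twice that radius multiplies the ball
  -- bound by `2 ^ γ` and the weight by `2 ^ (-p)`.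
  set q : ℝ := 2 ^ (γ - p) with hq
  have hq0 : 0 ≤ q := by positivity
  have hq1 : q < 1 := Real.rpow_lt_one_of_one_lt_of_neg (by norm_num) (by linarith)
  refine ⟨2 ^ p * (1 - q)⁻¹, mul_nonneg (by positivity) (inv_nonneg.2 (by linarith)),
    fun {d} μ C hC R hR x => ?_⟩
  -- The factor `2 ^ p` is needed because the least `k ≥ 1` with `R ‖x - y‖ < 2 ^ k` only guarantees
  -- `R ‖x - y‖ ≥ 2 ^ (k - 1)`.
  set c : ℕ → ℝ := fun k => 2 ^ p * ((2 : ℝ) ^ k) ^ (-p) with hc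
  have hc0 : ∀ k, 0 ≤ c k := fun k => by positivity
  have hpt : ∀ y, ENNReal.ofReal ((1 + R * ‖x - y‖) ^ (-p)) ≤
      ∑' k : ℕ, (ball x (2 ^ k / R)).indicator (fun _ => ENNReal.ofReal (c k)) y := by
    intro y
    have hex : ∃ k : ℕ, R * ‖x - y‖ < 2 ^ k := pow_unbounded_of_one_lt _ (by norm_num)
    classical
    have hk := Nat.find_spec hex
    have hmin := fun m => Nat.find_min hex (m := m)
    set k := Nat.find hex
    have hmem : y ∈ ball x (2 ^ k / R) := by
      rw [mem_ball', dist_eq_norm, lt_div_iff₀ hR, mul_comm]; exact hk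
    refine le_trans ?_ (ENNReal.le_tsum k)
    rw [indicator_of_mem hmem]
    apply ENNReal.ofReal_le_ofReal
    have hz : 0 ≤ R * ‖x - y‖ := by positivity
    rcases hk0 : k with _ | m
    · simp only [hc, pow_zero, Real.one_rpow, mul_one]
      calc (1 + R * ‖x - y‖) ^ (-p) ≤ 1 := Real.rpow_le_one_of_one_le_of_nonpos (by linarith) (by linarith)
        _ ≤ 2 ^ p := Real.one_le_rpow (by norm_num) hp
    · have hm : (2 : ℝ) ^ m ≤ R * ‖x - y‖ := not_lt.1 (hmin m (by omega))
      have : c (m + 1) = ((2 : ℝ) ^ m) ^ (-p) := by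
        simp only [hc]
        rw [pow_succ, Real.mul_rpow (by positivity) (by norm_num), mul_comm, mul_assoc,
          ← Real.rpow_add (by norm_num)]
        simp
      rw [this]
      exact Real.rpow_le_rpow_of_nonpos (by positivity) (by linarith) (by linarith)
  have hterm : ∀ k, c k * (C * (2 ^ k / R) ^ γ) = 2 ^ p * (C * R ^ (-γ)) * q ^ k := by
    intro k
    have e : ((2 : ℝ) ^ k) ^ (-p) * ((2 : ℝ) ^ k) ^ γ = q ^ k := by
      rw [← Real.rpow_add (by positivity), hq, ← Real.rpow_natCast, ← Real.rpow_natCast,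
        ← Real.rpow_mul (by norm_num), ← Real.rpow_mul (by norm_num)]
      congr 1; ring
    rw [Real.div_rpow (by positivity) hR.le, Real.rpow_neg hR.le, ← e]
    simp only [hc]
    ring
  calc ∫⁻ y, ENNReal.ofReal ((1 + R * ‖x - y‖) ^ (-p)) ∂μ
      ≤ ∫⁻ y, ∑' k : ℕ, (ball x (2 ^ k / R)).indicator (fun _ => ENNReal.ofReal (c k)) y ∂μ :=
        lintegral_mono hpt
    _ = ∑' k : ℕ, ENNReal.ofReal (c k) * μ (ball x (2 ^ k / R)) := by
        rw [lintegral_tsum fun k => (measurable_const.indicator measurableSet_ball).aemeasurable]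
        congr 1
        ext k
        rw [lintegral_indicator_const measurableSet_ball]
    _ ≤ ∑' k : ℕ, ENNReal.ofReal (2 ^ p * (C * R ^ (-γ)) * q ^ k) := by
        apply ENNReal.tsum_le_tsum
        intro k
        rw [← hterm, ENNReal.ofReal_mul (hc0 k)]
        gcongr
        exact hC x _ (by positivity)
    _ = ENNReal.ofReal (∑' k : ℕ, 2 ^ p * (C * R ^ (-γ)) * q ^ k) := by
        rw [ENNReal.ofReal_tsum_of_nonneg (fun k => by positivity)
          ((summable_geometric_of_lt_one hq0 hq1).mul_left _)]
    _ = _ := by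
        rw [tsum_mul_left, tsum_geometric_of_lt_one hq0 hq1]
        congr 1; ring

/-! ### Schur's test and the `TT*` method. -/

section TTStar

variable {X Y : Type*} [MeasurableSpace X] [MeasurableSpace Y]

/-- Schur's test for a Hermitian-symmetric kernel. -/
theorem norm_integral_integral_le_of_symm_kernel {ν : Measure X} [SFinite ν]
    {G : X → ℂ} {k : X → X → ℂ} {A : ℝ≥0∞} (hG : Measurable G)
    (hk : Measurable (Function.uncurry k)) (hsymm : ∀ x y, ‖k x y‖ₑ = ‖k y x‖ₑ)
    (hA : ∀ x, ∫⁻ y, ‖k x y‖ₑ ∂ν ≤ A) :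
    ‖∫ x, starRingEnd ℂ (G x) * ∫ y, G y * k x y ∂ν ∂ν‖ₑ ≤ A * ∫⁻ x, ‖G x‖ₑ ^ 2 ∂ν := by
  have hkm : Measurable (Function.uncurry fun x y => ‖k x y‖ₑ) := hk.enorm
  have h2 : ∀ a b : ℝ≥0∞, 2 * (a * b) ≤ a ^ 2 + b ^ 2 := by
    intro a b
    induction a with
    | top => simp
    | coe a =>
      induction b with
      | top => simp
      | coe b =>
        norm_cast
        have := two_mul_le_add_sq a b
        rwa [mul_assoc] at this
  have e1 : ∫⁻ x, ∫⁻ y, ‖G x‖ₑ ^ 2 * ‖k x y‖ₑ ∂ν ∂ν ≤ A * ∫⁻ x, ‖G x‖ₑ ^ 2 ∂ν := by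
    rw [← lintegral_const_mul _ (by fun_prop)]
    apply lintegral_mono
    intro x
    simp only
    rw [lintegral_const_mul _ (hkm.of_uncurry_left), mul_comm A]
    gcongr
    exact hA x
  -- Tonelli together with the symmetry of `‖k‖ₑ` reduces this to the previous bound, so row
  -- integrals alone suffice.
  have e2 : ∫⁻ x, ∫⁻ y, ‖G y‖ₑ ^ 2 * ‖k x y‖ₑ ∂ν ∂ν ≤ A * ∫⁻ x, ‖G x‖ₑ ^ 2 ∂ν := by
    rw [lintegral_lintegral_swap]
    · refine le_trans (le_of_eq ?_) e1
      congr 1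
      ext x
      congr 1
      ext y
      rw [hsymm]
    · exact Measurable.aemeasurable (((hG.comp measurable_snd).enorm.pow_const 2).mul hkm)
  have h3 : 2 * ∫⁻ x, ∫⁻ y, ‖G x‖ₑ * (‖G y‖ₑ * ‖k x y‖ₑ) ∂ν ∂ν ≤
      2 * (A * ∫⁻ x, ‖G x‖ₑ ^ 2 ∂ν) := by
    calc 2 * ∫⁻ x, ∫⁻ y, ‖G x‖ₑ * (‖G y‖ₑ * ‖k x y‖ₑ) ∂ν ∂ν
        = ∫⁻ x, ∫⁻ y, 2 * (‖G x‖ₑ * ‖G y‖ₑ) * ‖k x y‖ₑ ∂ν ∂ν := by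
          have hm : Measurable (Function.uncurry fun x y => ‖G x‖ₑ * (‖G y‖ₑ * ‖k x y‖ₑ)) :=
            (hG.comp measurable_fst).enorm.mul ((hG.comp measurable_snd).enorm.mul hkm)
          rw [← lintegral_const_mul _ hm.lintegral_prod_right]
          congr 1
          ext x
          rw [← lintegral_const_mul _ hm.of_uncurry_left]
          congr 1
          ext y
          ring
      _ ≤ ∫⁻ x, ∫⁻ y, (‖G x‖ₑ ^ 2 * ‖k x y‖ₑ + ‖G y‖ₑ ^ 2 * ‖k x y‖ₑ) ∂ν ∂ν := by
          apply lintegral_mono; intro x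
          apply lintegral_mono; intro y
          simp only
          rw [← add_mul]
          gcongr
          exact h2 _ _
      _ = ∫⁻ x, ∫⁻ y, ‖G x‖ₑ ^ 2 * ‖k x y‖ₑ ∂ν ∂ν + ∫⁻ x, ∫⁻ y, ‖G y‖ₑ ^ 2 * ‖k x y‖ₑ ∂ν ∂ν := by
          have hm : Measurable (Function.uncurry fun x y => ‖G x‖ₑ ^ 2 * ‖k x y‖ₑ) :=
            ((hG.comp measurable_fst).enorm.pow_const 2).mul hkm
          rw [← lintegral_add_left hm.lintegral_prod_right]
          congr 1
          ext x
          rw [← lintegral_add_left hm.of_uncurry_left]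
      _ ≤ 2 * (A * ∫⁻ x, ‖G x‖ₑ ^ 2 ∂ν) := by
          rw [two_mul]; exact add_le_add e1 e2
  refine le_trans ?_ ((ENNReal.mul_le_mul_iff_right (by norm_num) (by norm_num)).1 h3)
  refine (enorm_integral_le_lintegral_enorm _).trans (lintegral_mono fun x => ?_)
  simp only
  rw [enorm_mul, RCLike.enorm_conj]
  calc _ ≤ ‖G x‖ₑ * ∫⁻ y, ‖G y * k x y‖ₑ ∂ν := by
        gcongr; exact enorm_integral_le_lintegral_enorm _
    _ = _ := by
        simp_rw [enorm_mul]
        rw [lintegral_const_mul]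
        exact hG.enorm.mul hkm.of_uncurry_left

/-- The `TT*` method: an `L²` bound for `h ↦ ∫ e(x, η) h(η) dη` from a Schur bound on the kernel
of `TT*`. The weight `ψ` only has to dominate the indicator of the support of `h`. -/
theorem lintegral_enorm_sq_le_of_schur {ν : Measure X} [IsFiniteMeasure ν] {ρ : Measure Y} [SFinite ρ]
    {e : X → Y → ℂ} {ψ : Y → ℝ} {h : Y → ℂ} {A : ℝ}
    (he : Measurable (Function.uncurry e)) (he1 : ∀ x y, ‖e x y‖ = 1)
    (hψ : Integrable ψ ρ) (hψm : Measurable ψ) (hψ0 : ∀ y, 0 ≤ ψ y)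
    (hh : Integrable h ρ) (hhm : Measurable h) (hh2 : MemLp h 2 ρ)
    (hψh : ∀ᵐ y ∂ρ, h y ≠ 0 → 1 ≤ ψ y) (hA0 : 0 ≤ A)
    (hA : ∀ x, ∫⁻ y, ‖∫ η, e x η * starRingEnd ℂ (e y η) * ψ η ∂ρ‖ₑ ∂ν ≤ ENNReal.ofReal A) :
    ∫⁻ x, ‖∫ η, e x η * h η ∂ρ‖ₑ ^ 2 ∂ν ≤ ENNReal.ofReal A * ∫⁻ η, ‖h η‖ₑ ^ 2 ∂ρ := by
  set G : X → ℂ := fun x => ∫ η, e x η * h η ∂ρ with hG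
  have hmul : Measurable (Function.uncurry fun x η => e x η * h η) :=
    he.mul (hhm.comp measurable_snd)
  have hGm : Measurable G := hmul.stronglyMeasurable.integral_prod_right.measurable
  set B := ∫ η, ‖h η‖ ∂ρ with hB
  have hB0 : 0 ≤ B := integral_nonneg fun _ => norm_nonneg _
  have hGB : ∀ x, ‖G x‖ ≤ B := fun x => by
    refine (norm_integral_le_integral_norm _).trans (le_of_eq ?_)
    congr 1; ext η; rw [norm_mul, he1, one_mul]
  -- With `G = T h`, `D` is the complex conjugate of `T* G`. Boundedness of `G` and finiteness of
  -- `ν` justify the applications of Fubini.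
  set D : Y → ℂ := fun η => ∫ x, starRingEnd ℂ (G x) * e x η ∂ν with hD
  have hconj : Measurable (starRingEnd ℂ : ℂ → ℂ) := Complex.continuous_conj.measurable
  have hDmul : Measurable (Function.uncurry fun x η => starRingEnd ℂ (G x) * e x η) :=
    (hconj.comp (hGm.comp measurable_fst)).mul he
  have hDm : Measurable D :=
    hDmul.stronglyMeasurable.integral_prod_left.measurable
  set M := B * ν.real univ with hM
  have hDM : ∀ η, ‖D η‖ ≤ M := fun η => by
    refine norm_integral_le_of_norm_le_const (Filter.Eventually.of_forall fun x => ?_)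
    rw [norm_mul, he1, mul_one, RCLike.norm_conj]; exact hGB x
  set k : X → X → ℂ := fun x y => ∫ η, e x η * starRingEnd ℂ (e y η) * ψ η ∂ρ with hk
  have hkm : Measurable (Function.uncurry k) := by
    have : Measurable (fun q : (X × X) × Y =>
        e q.1.1 q.2 * starRingEnd ℂ (e q.1.2 q.2) * (ψ q.2 : ℂ)) :=
      ((he.comp ((measurable_fst.comp measurable_fst).prodMk measurable_snd)).mul
        (hconj.comp (he.comp ((measurable_snd.comp measurable_fst).prodMk measurable_snd)))).mul
        (Complex.measurable_ofReal.comp (hψm.comp measurable_snd))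
    exact this.stronglyMeasurable.integral_prod_right'.measurable
  have hksymm : ∀ x y, ‖k x y‖ₑ = ‖k y x‖ₑ := fun x y => by
    rw [← RCLike.enorm_conj (k x y)]
    congr 1
    simp only [hk]
    rw [← integral_conj]
    congr 1; ext η
    simp only [map_mul, Complex.conj_conj, Complex.conj_ofReal]
    ring
  have hprod : ∀ (u : Y → ℂ), Measurable u → Integrable u ρ → Integrable
      (Function.uncurry fun x η => starRingEnd ℂ (G x) * e x η * u η) (ν.prod ρ) := by
    intro u hum hu
    have h1 : Integrable (fun z : X × Y => B * ‖u z.2‖) (ν.prod ρ) :=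
      (hu.norm.comp_snd ν).const_mul B
    refine h1.mono' (hDmul.mul (hum.comp measurable_snd)).aestronglyMeasurable
      (Filter.Eventually.of_forall fun z => ?_)
    simp only [Function.uncurry]
    rw [norm_mul, norm_mul, he1, mul_one, RCLike.norm_conj]
    gcongr
    exact hGB z.1
  -- the energy identity
  set I := ∫ x, ‖G x‖ ^ 2 ∂ν with hI
  have hI0 : 0 ≤ I := integral_nonneg fun _ => sq_nonneg _
  have hGi : Integrable (fun x => ‖G x‖ ^ 2) ν := by
    refine Integrable.of_bound (hGm.norm.pow_const 2).aestronglyMeasurable (B ^ 2)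
      (Filter.Eventually.of_forall fun x => ?_)
    rw [Real.norm_eq_abs, abs_of_nonneg (sq_nonneg _)]
    gcongr; exact hGB x
  have hIl : ∫⁻ x, ‖G x‖ₑ ^ 2 ∂ν = ENNReal.ofReal I := by
    rw [hI, ofReal_integral_eq_lintegral_ofReal hGi (Filter.Eventually.of_forall fun x => sq_nonneg _)]
    congr 1; ext x
    rw [ENNReal.ofReal_pow (norm_nonneg _), ofReal_norm]
  have hI1 : (I : ℂ) = ∫ η, D η * h η ∂ρ := by
    have hs := integral_integral_swap (hprod h hhm hh)
    calc (I : ℂ) = ∫ x, ((‖G x‖ ^ 2 : ℝ) : ℂ) ∂ν := integral_complex_ofReal.symm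
      _ = ∫ x, ∫ η, starRingEnd ℂ (G x) * e x η * h η ∂ρ ∂ν := by
        congr 1; ext x
        simp_rw [mul_assoc]
        rw [integral_const_mul, mul_comm, Complex.mul_conj, Complex.normSq_eq_norm_sq]
      _ = ∫ η, ∫ x, starRingEnd ℂ (G x) * e x η * h η ∂ν ∂ρ := hs
      _ = _ := by
        congr 1; ext η
        rw [integral_mul_const]
  -- A weighted norm of `T* G`. Expanding the square yields the quadratic form of the kernel `k` in
  -- `G`, to which Schur's test applies.
  set Q := ∫ η, ψ η * ‖D η‖ ^ 2 ∂ρ with hQ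
  have hconjDm : Measurable (fun η => starRingEnd ℂ (D η)) := hconj.comp hDm
  have hu : Measurable (fun η => (ψ η : ℂ) * starRingEnd ℂ (D η)) :=
    (Complex.measurable_ofReal.comp hψm).mul hconjDm
  have hui : Integrable (fun η => (ψ η : ℂ) * starRingEnd ℂ (D η)) ρ := by
    refine (hψ.const_mul M).mono' hu.aestronglyMeasurable (Filter.Eventually.of_forall fun η => ?_)
    rw [norm_mul, RCLike.norm_conj, Complex.norm_real, Real.norm_eq_abs, abs_of_nonneg (hψ0 η),
      mul_comm]
    exact mul_le_mul_of_nonneg_right (hDM η) (hψ0 η)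
  have hQ1 : (Q : ℂ) = ∫ x, starRingEnd ℂ (G x) * ∫ y, G y * k x y ∂ν ∂ν := by
    have hs := integral_integral_swap (hprod _ hu hui)
    calc (Q : ℂ) = ∫ η, ((ψ η * ‖D η‖ ^ 2 : ℝ) : ℂ) ∂ρ := integral_complex_ofReal.symm
      _ = ∫ η, ∫ x, starRingEnd ℂ (G x) * e x η * ((ψ η : ℂ) * starRingEnd ℂ (D η)) ∂ν ∂ρ := by
        congr 1; ext η
        rw [integral_mul_const, Complex.ofReal_mul, ← Complex.normSq_eq_norm_sq, ← Complex.mul_conj]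
        ring
      _ = ∫ x, ∫ η, starRingEnd ℂ (G x) * e x η * ((ψ η : ℂ) * starRingEnd ℂ (D η)) ∂ρ ∂ν := hs.symm
      _ = _ := by
        congr 1; ext x
        simp_rw [mul_assoc]
        rw [integral_const_mul]
        congr 1
        have hi : Integrable (Function.uncurry fun (y : X) (η : Y) =>
            e x η * ((ψ η : ℂ) * (G y * starRingEnd ℂ (e y η)))) (ν.prod ρ) := by
          have h1 : Integrable (fun z : X × Y => B * ψ z.2) (ν.prod ρ) :=
            (hψ.comp_snd ν).const_mul B
          have hem : Measurable (e x) := he.of_uncurry_left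
          refine h1.mono' (((hem.comp measurable_snd).mul
            ((Complex.measurable_ofReal.comp (hψm.comp measurable_snd)).mul
              ((hGm.comp measurable_fst).mul (hconj.comp he)))).aestronglyMeasurable)
            (Filter.Eventually.of_forall fun z => ?_)
          simp only [Function.uncurry]
          rw [norm_mul, norm_mul, norm_mul, he1, one_mul, RCLike.norm_conj, he1, mul_one,
            Complex.norm_real, Real.norm_eq_abs, abs_of_nonneg (hψ0 _), mul_comm]
          exact mul_le_mul_of_nonneg_right (hGB _) (hψ0 _)
        have hs2 := integral_integral_swap hi
        calc ∫ η, e x η * ((ψ η : ℂ) * starRingEnd ℂ (D η)) ∂ρ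
            = ∫ η, ∫ y, e x η * ((ψ η : ℂ) * (G y * starRingEnd ℂ (e y η))) ∂ν ∂ρ := by
              congr 1; ext η
              rw [integral_const_mul, integral_const_mul]
              simp only [hD]
              rw [← integral_conj]
              simp only [map_mul, Complex.conj_conj]
          _ = ∫ y, ∫ η, e x η * ((ψ η : ℂ) * (G y * starRingEnd ℂ (e y η))) ∂ρ ∂ν := hs2.symm
          _ = _ := by
              congr 1; ext y
              simp only [hk]
              rw [← integral_const_mul]
              congr 1; ext η
              ring
  have hQ0 : 0 ≤ Q := integral_nonneg fun η => mul_nonneg (hψ0 η) (sq_nonneg _)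
  have hQA : Q ≤ A * I := by
    have := norm_integral_integral_le_of_symm_kernel hGm hkm hksymm hA
    rw [← hQ1, hIl, ← ENNReal.ofReal_mul hA0, ← ofReal_norm, Complex.norm_real, Real.norm_eq_abs,
      abs_of_nonneg hQ0] at this
    exact (ENNReal.ofReal_le_ofReal_iff (by positivity)).1 this
  have hhi : Integrable (fun η => ‖h η‖ ^ 2) ρ := by
    simpa using hh2.integrable_norm_pow (by norm_num)
  set S := ∫ η, ‖h η‖ ^ 2 ∂ρ with hS
  have hS0 : 0 ≤ S := integral_nonneg fun _ => sq_nonneg _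
  have hQi : Integrable (fun η => ψ η * ‖D η‖ ^ 2) ρ := by
    refine (hψ.const_mul (M ^ 2)).mono' (hψm.mul (hDm.norm.pow_const 2)).aestronglyMeasurable
      (Filter.Eventually.of_forall fun η => ?_)
    rw [Real.norm_eq_abs, abs_of_nonneg (mul_nonneg (hψ0 η) (sq_nonneg _)), mul_comm]
    gcongr
    · exact hψ0 η
    · exact hDM η
  -- Cauchy–Schwarz in the form `2 |D h| ≤ A |h|² + A⁻¹ ψ |D|²`
  have hIS : I ≤ A * S := by
    rcases hI0.eq_or_lt with hIz | hIpos
    · rw [← hIz]; positivity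
    have hcs : ∀ lam : ℝ, 0 < lam → 2 * I ≤ lam * S + lam⁻¹ * Q := by
      intro lam hlam
      have hn : I ≤ ∫ η, ‖D η * h η‖ ∂ρ := by
        have := norm_integral_le_integral_norm (μ := ρ) (fun η => D η * h η)
        rwa [← hI1, Complex.norm_real, Real.norm_eq_abs, abs_of_nonneg hI0] at this
      have hle : ∫ η, 2 * ‖D η * h η‖ ∂ρ ≤ ∫ η, (lam * ‖h η‖ ^ 2 + lam⁻¹ * (ψ η * ‖D η‖ ^ 2)) ∂ρ := by
        apply integral_mono_ae
        · have : Integrable (fun η => D η * h η) ρ := by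
            refine (hh.norm.const_mul M).mono' (hDm.mul hhm).aestronglyMeasurable
              (Filter.Eventually.of_forall fun η => ?_)
            rw [norm_mul]; gcongr; exact hDM η
          exact this.norm.const_mul 2
        · exact (hhi.const_mul _).add (hQi.const_mul _)
        · filter_upwards [hψh] with η hη
          by_cases h0 : h η = 0
          · simp only [h0, mul_zero, norm_zero]
            have := hψ0 η
            positivity
          · have h1 := hη h0
            simp only [norm_mul]
            have h2 : lam⁻¹ * (1 * ‖D η‖ ^ 2) ≤ lam⁻¹ * (ψ η * ‖D η‖ ^ 2) := by gcongr
            have h3 : 0 ≤ lam⁻¹ * (lam * ‖h η‖ - ‖D η‖) ^ 2 := by positivity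
            have h4 : lam⁻¹ * (lam * ‖h η‖ - ‖D η‖) ^ 2 =
                lam * ‖h η‖ ^ 2 - 2 * (‖D η‖ * ‖h η‖) + lam⁻¹ * (1 * ‖D η‖ ^ 2) := by
              field_simp; ring
            linarith
      rw [integral_const_mul, integral_add (hhi.const_mul _) (hQi.const_mul _), integral_const_mul,
        integral_const_mul] at hle
      linarith
    -- When `A = 0` the choice `lam = A` is unavailable; then `Q = 0`, and `lam = I / (S + 1)` gives
    -- `2 I ≤ I`, contradicting `I > 0`.
    rcases hA0.eq_or_lt with hAz | hApos
    · have hQz : Q = 0 := le_antisymm (by rw [← hAz, zero_mul] at hQA; exact hQA) hQ0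
      have := hcs (I / (S + 1)) (by positivity)
      rw [hQz, mul_zero, add_zero] at this
      have : I / (S + 1) * S ≤ I := by
        rw [div_mul_eq_mul_div, div_le_iff₀ (by positivity)]; nlinarith
      linarith
    · have := hcs A hApos
      have h5 : A⁻¹ * Q ≤ I := by
        rw [inv_mul_le_iff₀ hApos]; exact hQA
      linarith
  have hSl : ∫⁻ η, ‖h η‖ₑ ^ 2 ∂ρ = ENNReal.ofReal S := by
    rw [hS, ofReal_integral_eq_lintegral_ofReal hhi (Filter.Eventually.of_forall fun x => sq_nonneg _)]
    congr 1; ext x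
    rw [ENNReal.ofReal_pow (norm_nonneg _), ofReal_norm]
  rw [hIl, hSl, ← ENNReal.ofReal_mul hA0]
  exact ENNReal.ofReal_le_ofReal hIS

end TTStar

/-! ### The propagator, its `TT*` kernel and linearisation of the supremum. -/

section Propagator

variable {d : ℕ}

/-- The plane wave `exp (i (x · ξ + t |ξ| ^ α))` at frequency `ξ = 2πη`. -/
noncomputable def planeWave (α t : ℝ) (x η : Rd d) : ℂ :=
  Complex.exp (Complex.I * ((2 * Real.pi * inner ℝ x η + t * (2 * Real.pi * ‖η‖) ^ α : ℝ) : ℂ))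

theorem norm_planeWave (α t : ℝ) (x η : Rd d) : ‖planeWave α t x η‖ = 1 := by
  rw [planeWave, mul_comm]; exact Complex.norm_exp_ofReal_mul_I _

theorem measurable_planeWave_comp {α : ℝ} (hα : 0 < α) {τ : Rd d → ℝ} (hτ : Measurable τ) :
    Measurable (Function.uncurry fun x η : Rd d => planeWave α (τ x) x η) := by
  have h1 : Measurable (fun z : Rd d × Rd d => inner ℝ z.1 z.2) :=
    (by fun_prop : Continuous (fun z : Rd d × Rd d => inner ℝ z.1 z.2)).measurable
  have h2 := (Real.continuous_rpow_const hα.le).measurable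
  unfold planeWave Function.uncurry
  fun_prop

theorem fracSchrodinger_eq (α t : ℝ) (f : Lp ℂ 2 (volume : Measure (Rd d))) (x : Rd d) :
    fracSchrodinger α t f x = ∫ η, planeWave α t x η * (𝓕 f : Lp ℂ 2 (volume : Measure (Rd d))) η := by
  rw [fracSchrodinger, Real.fourierInv_eq']
  congr 1
  ext η
  rw [smul_eq_mul, ← mul_assoc, ← Complex.exp_add, planeWave]
  congr 2
  rw [real_inner_comm]
  push_cast
  ring

/-- An `L²` function vanishing off a set of finite measure is integrable; the ball of radius `R` is
a crude container for `2π‖η‖ ≤ 2R`. -/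
theorem FourierSupportedInAnnulus.integrable {R : ℝ} {f : Lp ℂ 2 (volume : Measure (Rd d))}
    (hf : FourierSupportedInAnnulus R f) :
    Integrable (𝓕 f : Lp ℂ 2 (volume : Measure (Rd d))) := by
  have h2 := Lp.memLp (𝓕 f : Lp ℂ 2 (volume : Measure (Rd d)))
  have h1 : IntegrableOn (𝓕 f : Lp ℂ 2 (volume : Measure (Rd d))) (closedBall 0 R) := by
    have : IsFiniteMeasure ((volume : Measure (Rd d)).restrict (closedBall 0 R)) :=
      ⟨by rw [Measure.restrict_apply_univ]; exact measure_closedBall_lt_top⟩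
    exact (h2.restrict (closedBall 0 R)).integrable (by norm_num)
  refine h1.integrable_of_ae_notMem_eq_zero ?_
  filter_upwards [hf] with η hη hmem
  refine hη fun h => hmem ?_
  rw [mem_closedBall_zero_iff]
  have := Real.pi_gt_three
  nlinarith [norm_nonneg η]

/-- Dominated convergence with majorant `‖h‖`. Joint continuity provides both measurability and the
reduction of the supremum to countably many times. -/
theorem continuous_integral_planeWave_mul {α : ℝ} (hα : 0 < α) {h : Rd d → ℂ} (hh : Integrable h) :
    Continuous (fun z : ℝ × Rd d => ∫ η, planeWave α z.1 z.2 η * h η) := by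
  refine continuous_of_dominated (bound := fun η => ‖h η‖) (fun z => ?_)
    (fun z => Filter.Eventually.of_forall fun η => ?_)
    hh.norm (Filter.Eventually.of_forall fun η => ?_)
  · have : Continuous (fun η => planeWave α z.1 z.2 η) := by
      have := Real.continuous_rpow_const hα.le
      unfold planeWave
      fun_prop
    exact this.aestronglyMeasurable.mul hh.aestronglyMeasurable
  · rw [norm_mul, norm_planeWave, one_mul]
  · have : Continuous (fun z : ℝ × Rd d => planeWave α z.1 z.2 η) := by
      unfold planeWave
      fun_prop
    exact this.mul continuous_const

theorem FourierSupportedInAnnulus.continuous_fracSchrodinger {α R : ℝ} (hα : 0 < α)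
    {f : Lp ℂ 2 (volume : Measure (Rd d))} (hf : FourierSupportedInAnnulus R f) :
    Continuous (fun z : ℝ × Rd d => fracSchrodinger α z.1 f z.2) := by
  simp_rw [fracSchrodinger_eq]
  exact continuous_integral_planeWave_mul hα hf.integrable

/-- The kernel of `TT*` is a rescaled `annulusKernel`. -/
theorem integral_planeWave_mul_conj_eq {α R : ℝ} (hR : 0 < R) (t t' : ℝ) (x y : Rd d) :
    ∫ η, planeWave α t x η * starRingEnd ℂ (planeWave α t' y η) *
      (squaredAnnulusBump (‖(2 * Real.pi / R) • η‖ ^ 2) : ℂ) =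
      ((R / (2 * Real.pi)) ^ d : ℝ) * annulusKernel α ((t - t') * R ^ α) (R • (x - y)) := by
  have hpi := Real.pi_pos
  have hc : 0 < 2 * Real.pi / R := by positivity
  -- Substitution `ξ = (2π / R) η`, which accounts for the Jacobian `(R / 2π) ^ d`.
  have h := Measure.integral_comp_smul (volume : Measure (Rd d)) (fun ξ : Rd d =>
    Complex.exp (Complex.I * (inner ℝ (R • (x - y)) ξ : ℝ)) *
    (Complex.exp (Complex.I * (((t - t') * R ^ α * ‖ξ‖ ^ α : ℝ) : ℂ)) *
      (squaredAnnulusBump (‖ξ‖ ^ 2) : ℂ))) (2 * Real.pi / R)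
  rw [finrank_euclideanSpace_fin, abs_of_pos (by positivity), Complex.real_smul, ← inv_pow,
    inv_div] at h
  rw [annulusKernel, ← h]
  congr 1
  ext η
  rw [← mul_assoc]
  congr 1
  rw [planeWave, planeWave, ← Complex.exp_conj, ← Complex.exp_add, ← Complex.exp_add]
  congr 1
  rw [map_mul, Complex.conj_I, Complex.conj_ofReal, norm_smul, Real.norm_eq_abs, abs_of_pos hc,
    real_inner_smul_left, real_inner_smul_right, inner_sub_left]
  have e1 : R ^ α * (2 * Real.pi / R * ‖η‖) ^ α = (2 * Real.pi * ‖η‖) ^ α := by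
    rw [← Real.mul_rpow hR.le (by positivity)]
    congr 1; field_simp
  have e2 : R * (2 * Real.pi / R * (inner ℝ x η - inner ℝ y η)) =
      2 * Real.pi * (inner ℝ x η - inner ℝ y η) := by field_simp
  rw [e2, mul_assoc (t - t'), e1]
  push_cast
  ring

/-- The maximal estimate for a measurable choice of times. -/
theorem lintegral_fracSchrodinger_comp_le {α R B p T A γ : ℝ} {C : ℝ≥0} (hα : 0 < α) (hR : 0 < R)
    (hB0 : 0 ≤ B) (hA0 : 0 ≤ A)
    (hB : ∀ (t : ℝ) (w : Rd d), |t| ≤ T → ‖annulusKernel α t w‖ * (1 + ‖w‖) ^ p ≤ B)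
    {μ : Measure (Rd d)} (hμ : IsBallBound γ μ C)
    (hA : ∀ x : Rd d, ∫⁻ y, ENNReal.ofReal ((1 + R * ‖x - y‖) ^ (-p)) ∂μ ≤
      ENNReal.ofReal (A * (C * R ^ (-γ))))
    {f : Lp ℂ 2 (volume : Measure (Rd d))} (hf : FourierSupportedInAnnulus R f)
    {τ : Rd d → ℝ} (hτ : Measurable τ) (hτT : ∀ x y, |τ x - τ y| * R ^ α ≤ T) :
    ∫⁻ x in ball 0 1, ‖fracSchrodinger α (τ x) f x‖ₑ ^ 2 ∂μ ≤
      ENNReal.ofReal (R ^ d * B * (A * (C * R ^ (-γ)))) * ‖f‖ₑ ^ 2 := by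
  have hpi := Real.pi_gt_three
  have hfin : IsFiniteMeasure (μ.restrict (ball (0 : Rd d) 1)) :=
    ⟨by rw [Measure.restrict_apply_univ]
        exact (hμ 0 1 one_pos).trans_lt ENNReal.ofReal_lt_top⟩
  set h : Rd d → ℂ := ⇑(𝓕 f : Lp ℂ 2 (volume : Measure (Rd d))) with hh
  have hψc : Continuous (fun η : Rd d => squaredAnnulusBump (‖(2 * Real.pi / R) • η‖ ^ 2)) := by
    have := squaredAnnulusBump.continuous
    fun_prop
  have hc : 0 < 2 * Real.pi / R := by positivity
  have hψs : HasCompactSupport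
      (fun η : Rd d => squaredAnnulusBump (‖(2 * Real.pi / R) • η‖ ^ 2)) := by
    apply HasCompactSupport.intro (isCompact_closedBall (0 : Rd d) R)
    intro η hη
    rw [mem_closedBall_zero_iff, not_le] at hη
    apply squaredAnnulusBump_eq_zero (Or.inr _)
    have : 3 ≤ 2 * Real.pi / R * ‖η‖ := by
      rw [div_mul_eq_mul_div, le_div_iff₀ hR]; nlinarith
    rw [norm_smul, Real.norm_eq_abs, abs_of_pos hc]
    nlinarith
  have key := lintegral_enorm_sq_le_of_schur (ν := μ.restrict (ball (0 : Rd d) 1))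
    (ρ := (volume : Measure (Rd d))) (e := fun x η => planeWave α (τ x) x η)
    (ψ := fun η => squaredAnnulusBump (‖(2 * Real.pi / R) • η‖ ^ 2)) (h := h)
    (A := R ^ d * B * (A * (C * R ^ (-γ))))
    (measurable_planeWave_comp hα hτ)
    (fun x η => norm_planeWave _ _ _ _) (hψc.integrable_of_hasCompactSupport hψs) hψc.measurable
    (fun η => squaredAnnulusBump.nonneg) hf.integrable
    (Lp.stronglyMeasurable (𝓕 f : Lp ℂ 2 (volume : Measure (Rd d)))).measurable
    (Lp.memLp (𝓕 f : Lp ℂ 2 (volume : Measure (Rd d))))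
    -- On the frequency annulus the rescaled norm lies in `[1, 2]` and its square in `[1, 4]`, where
    -- the cutoff equals one.
    (by
      filter_upwards [hf] with η hη hne
      by_contra hlt
      refine hne (hη fun hmem => hlt (le_of_eq ?_))
      have e : ‖(2 * Real.pi / R) • η‖ = 2 * Real.pi * ‖η‖ / R := by
        rw [norm_smul, Real.norm_eq_abs, abs_of_pos hc, div_mul_eq_mul_div]
      have h1 : 1 ≤ ‖(2 * Real.pi / R) • η‖ := by rw [e, le_div_iff₀ hR]; linarith [hmem.1]
      have h2 : ‖(2 * Real.pi / R) • η‖ ≤ 2 := by rw [e, div_le_iff₀ hR]; exact hmem.2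
      symm
      apply squaredAnnulusBump_eq_one <;> nlinarith)
    (by positivity)
    (by
      intro x
      calc _ ≤ ∫⁻ y, ENNReal.ofReal (R ^ d * B) * ENNReal.ofReal ((1 + R * ‖x - y‖) ^ (-p)) ∂μ := by
            -- The unit ball serves only to make the measure finite; the Schur integral is bounded
            -- over all of `μ`.
            refine (lintegral_mono fun y => ?_).trans (setLIntegral_le_lintegral _ _)
            simp only
            rw [integral_planeWave_mul_conj_eq hR, ← ENNReal.ofReal_mul (by positivity), ← ofReal_norm]
            apply ENNReal.ofReal_le_ofReal
            rw [norm_mul, Complex.norm_real, Real.norm_eq_abs, abs_of_pos (by positivity)]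
            have hT : |(τ x - τ y) * R ^ α| ≤ T := by
              rw [abs_mul, abs_of_pos (Real.rpow_pos_of_pos hR α)]; exact hτT x y
            have hk := hB _ (R • (x - y)) hT
            rw [norm_smul, Real.norm_eq_abs, abs_of_pos hR] at hk
            have hp0 : 0 < 1 + R * ‖x - y‖ := by positivity
            have hk' : ‖annulusKernel α ((τ x - τ y) * R ^ α) (R • (x - y))‖ ≤
                B * (1 + R * ‖x - y‖) ^ (-p) := by
              rw [Real.rpow_neg hp0.le, ← div_eq_mul_inv, le_div_iff₀ (by positivity)]
              exact hk
            have hRd : (R / (2 * Real.pi)) ^ d ≤ R ^ d := by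
              gcongr
              exact div_le_self hR.le (by linarith)
            exact (mul_le_mul hRd hk' (norm_nonneg _) (by positivity)).trans (le_of_eq (by ring))
        _ = ENNReal.ofReal (R ^ d * B) * ∫⁻ y, ENNReal.ofReal ((1 + R * ‖x - y‖) ^ (-p)) ∂μ := by
            rw [lintegral_const_mul' _ _ ENNReal.ofReal_ne_top]
        _ ≤ _ := by
            rw [ENNReal.ofReal_mul (p := R ^ d * B) (by positivity)]
            exact mul_le_mul_right (hA x) _)
  simp_rw [fracSchrodinger_eq]
  refine key.trans (le_of_eq ?_)
  congr 1
  have hn : ‖(𝓕 f : Lp ℂ 2 (volume : Measure (Rd d)))‖ₑ = ‖f‖ₑ := by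
    rw [← ofReal_norm, ← ofReal_norm, Lp.norm_fourier_eq]
  rw [← hn, Lp.enorm_def, eLpNorm_eq_lintegral_rpow_enorm_toReal (by norm_num) (by norm_num)]
  simp only [ENNReal.toReal_ofNat, one_div]
  rw [← ENNReal.rpow_natCast, ← ENNReal.rpow_mul]
  norm_num
  rfl

/-- The running argmax of `|F (q n) x|`, `n ≤ N`. -/
noncomputable def runningArgmax {X : Type*} (F : ℝ → X → ℝ≥0∞) (q : ℕ → ℝ) : ℕ → X → ℝ
  | 0, _ => q 0
  | n + 1, x => open Classical in
    if F (runningArgmax F q n x) x < F (q (n + 1)) x then q (n + 1) else runningArgmax F q n x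

theorem measurable_runningArgmax {X : Type*} [MeasurableSpace X] {F : ℝ → X → ℝ≥0∞}
    (hF : Measurable (Function.uncurry F)) (q : ℕ → ℝ) (n : ℕ) : Measurable (runningArgmax F q n) := by
  induction n with
  | zero => exact measurable_const
  | succ n ih =>
    refine Measurable.ite ?_ measurable_const ih
    exact measurableSet_lt (hF.comp (ih.prodMk measurable_id)) (hF.comp (measurable_const.prodMk measurable_id))

theorem runningArgmax_mem {X : Type*} {F : ℝ → X → ℝ≥0∞} {q : ℕ → ℝ} {I : Set ℝ} (hq : ∀ n, q n ∈ I)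
    (n : ℕ) (x : X) : runningArgmax F q n x ∈ I := by
  induction n with
  | zero => exact hq 0
  | succ n ih => rw [runningArgmax]; split_ifs; exacts [hq _, ih]

/-- Monotonicity in `n` is what permits monotone convergence along the selected times. -/
theorem runningArgmax_mono {X : Type*} (F : ℝ → X → ℝ≥0∞) (q : ℕ → ℝ) (x : X) :
    Monotone fun n => F (runningArgmax F q n x) x := by
  refine monotone_nat_of_le_succ fun n => ?_
  simp only [runningArgmax]
  split_ifs with h
  exacts [h.le, le_refl _]

theorem le_runningArgmax {X : Type*} (F : ℝ → X → ℝ≥0∞) (q : ℕ → ℝ) (n : ℕ) (x : X) :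
    F (q n) x ≤ F (runningArgmax F q n x) x := by
  cases n with
  | zero => exact le_refl _
  | succ n =>
    simp only [runningArgmax]
    split_ifs with h
    exacts [le_refl _, not_lt.1 h]

/-- A bound for all measurable selections of times bounds the supremum. -/
theorem measurable_iSup_and_lintegral_iSup_sq_le {X : Type*} [MeasurableSpace X] {ν : Measure X}
    {F : ℝ → X → ℝ≥0∞} (hF : Measurable (Function.uncurry F)) (hFc : ∀ x, Continuous fun t => F t x)
    {I : Set ℝ} (hI : I.Nonempty) {K : ℝ≥0∞}
    (hK : ∀ τ : X → ℝ, Measurable τ → (∀ x, τ x ∈ I) → ∫⁻ x, F (τ x) x ^ 2 ∂ν ≤ K) :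
    Measurable (fun x => ⨆ t ∈ I, F t x) ∧ ∫⁻ x, (⨆ t ∈ I, F t x) ^ 2 ∂ν ≤ K := by
  have : Nonempty I := hI.to_subtype
  set q : ℕ → ℝ := fun n => (TopologicalSpace.denseSeq I n : ℝ) with hq
  have hqI : ∀ n, q n ∈ I := fun n => (TopologicalSpace.denseSeq I n).2
  -- Continuity in `t` reduces the supremum to a dense sequence, whose partial maxima are attained
  -- at the measurable running argmax.
  have hsup : ∀ x, ⨆ t ∈ I, F t x = ⨆ n, F (runningArgmax F q n x) x := by
    intro x
    apply le_antisymm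
    · refine iSup₂_le fun t ht => ?_
      have hclosed : IsClosed {t : I | F t x ≤ ⨆ n, F (runningArgmax F q n x) x} :=
        isClosed_le ((hFc x).comp continuous_subtype_val) continuous_const
      exact DenseRange.induction_on (p := fun t : I => F t x ≤ ⨆ n, F (runningArgmax F q n x) x)
        (TopologicalSpace.denseRange_denseSeq I) (⟨t, ht⟩ : I) hclosed
        fun n => (le_runningArgmax F q n x).trans (le_iSup (fun n => F (runningArgmax F q n x) x) n)
    · exact iSup_le fun n => le_iSup₂_of_le _ (runningArgmax_mem hqI n x) le_rfl
  have hm : ∀ n, Measurable fun x => F (runningArgmax F q n x) x := fun n =>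
    hF.comp ((measurable_runningArgmax hF q n).prodMk measurable_id)
  simp_rw [hsup]
  refine ⟨Measurable.iSup hm, ?_⟩
  have hsq : ∀ x, (⨆ n, F (runningArgmax F q n x) x) ^ 2 =
      ⨆ n, F (runningArgmax F q n x) x ^ 2 := fun x =>
    (Monotone.map_iSup_of_continuousAt (f := fun a : ℝ≥0∞ => a ^ 2)
      (ENNReal.continuous_pow 2).continuousAt (fun a b h => pow_le_pow_left' h 2) (by simp))
  simp_rw [hsq]
  rw [lintegral_iSup (fun n => (hm n).pow_const 2)
    (fun a b h x => by simp only; gcongr; exact runningArgmax_mono F q x h)]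
  exact iSup_le fun n => hK _ (measurable_runningArgmax hF q n) (runningArgmax_mem hqI n)

end Propagator

/-! ### The maximal estimates. -/

/-- The maximal estimate over a set of times of diameter at most `T R ^ (-α)`. -/
theorem lintegral_iSup_fracSchrodinger_le {d : ℕ} {α R B p T A γ : ℝ} {C : ℝ≥0} (hα : 0 < α) (hR : 0 < R)
    (hB0 : 0 ≤ B) (hA0 : 0 ≤ A)
    (hB : ∀ (t : ℝ) (w : Rd d), |t| ≤ T → ‖annulusKernel α t w‖ * (1 + ‖w‖) ^ p ≤ B)
    {μ : Measure (Rd d)} (hμ : IsBallBound γ μ C)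
    (hA : ∀ x : Rd d, ∫⁻ y, ENNReal.ofReal ((1 + R * ‖x - y‖) ^ (-p)) ∂μ ≤
      ENNReal.ofReal (A * (C * R ^ (-γ))))
    {f : Lp ℂ 2 (volume : Measure (Rd d))} (hf : FourierSupportedInAnnulus R f)
    {I : Set ℝ} (hI : I.Nonempty) (hIT : ∀ t ∈ I, ∀ t' ∈ I, |t - t'| * R ^ α ≤ T) :
    Measurable (fun x => ⨆ t ∈ I, ‖fracSchrodinger α t f x‖ₑ) ∧
    ∫⁻ x in ball 0 1, (⨆ t ∈ I, ‖fracSchrodinger α t f x‖ₑ) ^ 2 ∂μ ≤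
      ENNReal.ofReal (R ^ d * B * (A * (C * R ^ (-γ)))) * ‖f‖ₑ ^ 2 := by
  have hc := hf.continuous_fracSchrodinger hα
  have hm : Measurable (Function.uncurry fun (t : ℝ) (x : Rd d) => ‖fracSchrodinger α t f x‖ₑ) := by
    unfold Function.uncurry
    exact hc.measurable.enorm
  have hct : ∀ x : Rd d, Continuous fun t : ℝ => ‖fracSchrodinger α t f x‖ₑ := fun x => by
    have h1 : Continuous fun t : ℝ => fracSchrodinger α t f x := hc.along_fst
    exact h1.enorm
  refine measurable_iSup_and_lintegral_iSup_sq_le hm hct hI fun τ hτ hτI => ?_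
  exact lintegral_fracSchrodinger_comp_le hα hR hB0 hA0 hB hμ hA hf hτ
    fun x y => hIT _ (hτI x) _ (hτI y)

/-- The squared form of the maximal estimate. -/
theorem exists_lintegral_maximalFunction_sq_le {d : ℕ} (hd : 1 ≤ d) {α γ s : ℝ} (hα0 : 0 < α)
    (hα1 : α < 1) (hγ0 : 0 < γ) (hs : min (max 0 (α * (γ / 2 - (d : ℝ) / 4))) (α / 2) < s) :
    ∃ C : ℝ, 0 ≤ C ∧ ∀ μ : Measure (Rd d), IsGammaDimensional γ μ → ∀ R : ℝ, 1 ≤ R →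
      ∀ f : Lp ℂ 2 (volume : Measure (Rd d)), FourierSupportedInAnnulus R f →
        ∫⁻ x in ball 0 1, maximalFunction α f x ^ 2 ∂μ ≤
          ENNReal.ofReal (C * R ^ ((d : ℝ) - γ + 2 * s) * dimConst γ μ) * ‖f‖ₑ ^ 2 := by
  rcases min_lt_iff.1 hs with hs | hs
  · have hs0 : 0 < s := (le_max_left _ _).trans_lt hs
    -- Chosen so that `(R ^ α) ^ σ = R ^ (2 * s)`; the hypothesis on `s` becomes `σ > max 0 (γ -
    -- d/2)`.
    set σ := 2 * s / α with hσ
    have hσ0 : 0 < σ := by positivity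
    have hσγ : γ - (d : ℝ) / 2 < σ := by
      rw [hσ, lt_div_iff₀ hα0]
      have := (le_max_right _ _).trans_lt hs
      linarith
    -- Half of the gap: one `δ` raises the weight to `p = γ + δ`, above `γ`, and the other is the
    -- margin required by the kernel bound.
    set δ := (σ - max 0 (γ - (d : ℝ) / 2)) / 2 with hδ
    have hδ0 : 0 < δ := by
      have : max 0 (γ - (d : ℝ) / 2) < σ := max_lt hσ0 hσγ
      rw [hδ]; linarith
    obtain ⟨B, hB0, hB⟩ := exists_norm_annulusKernel_le_of_abs_le hd hα0 hα1 (p := γ + δ)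
      (by linarith) hσ0 hδ0 (by have := le_max_right 0 (γ - (d : ℝ) / 2); rw [hδ]; linarith)
    obtain ⟨A, hA0, hA⟩ := exists_lintegral_one_add_rpow_le (γ := γ) (p := γ + δ) (by linarith)
      (by linarith)
    refine ⟨B * A, by positivity, fun μ hμ R hR f hf => ?_⟩
    have hR0 : 0 < R := by linarith
    have hμC := isBallBound_dimConst hμ
    have hRα : 1 ≤ R ^ α := Real.one_le_rpow hR hα0.le
    have := (lintegral_iSup_fracSchrodinger_le hα0 hR0 (B := B * (R ^ α) ^ σ) (by positivity) hA0
      (fun t w ht => hB (R ^ α) t w hRα ht) hμC (hA μ _ hμC R hR0) hf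
      (I := Ioc 0 1) ⟨1, by norm_num, le_refl _⟩ (fun t ht t' ht' => by
        have : |t - t'| ≤ 1 := by
          rw [abs_le]; constructor <;> linarith [ht.1, ht.2, ht'.1, ht'.2]
        exact mul_le_of_le_one_left (by linarith) this)).2
    refine this.trans (le_of_eq ?_)
    congr 2
    have e1 : (R ^ α) ^ σ = R ^ (2 * s) := by
      rw [← Real.rpow_mul hR0.le]; congr 1; rw [hσ]; field_simp
    have e2 : R ^ ((d : ℝ) - γ + 2 * s) = R ^ d * R ^ (-γ) * R ^ (2 * s) := by
      rw [← Real.rpow_natCast, ← Real.rpow_add hR0, ← Real.rpow_add hR0]; congr 1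
    rw [e1, e2]; ring
  · obtain ⟨B, hB0, hB⟩ := exists_norm_annulusKernel_le_of_abs_le_one hd α (p := γ + 1) (by linarith)
    obtain ⟨A, hA0, hA⟩ := exists_lintegral_one_add_rpow_le (γ := γ) (p := γ + 1) (by linarith)
      (by linarith)
    refine ⟨2 * (B * A), by positivity, fun μ hμ R hR f hf => ?_⟩
    have hR0 : 0 < R := by linarith
    have hμC := isBallBound_dimConst hμ
    have hRα : 1 ≤ R ^ α := Real.one_le_rpow hR hα0.le
    -- Intervals of length `1 / n ≤ R ^ (-α)` have rescaled length at most one. Summing over them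
    -- costs `n ≤ 2 R ^ α ≤ 2 R ^ (2 * s)`.
    set n := ⌈R ^ α⌉₊ with hn
    have hnR : R ^ α ≤ n := Nat.le_ceil _
    have hn0 : (0 : ℝ) < n := by linarith
    have hn2 : (n : ℝ) ≤ 2 * R ^ α := by
      have := Nat.ceil_lt_add_one (a := R ^ α) (by linarith)
      linarith
    set I : ℕ → Set ℝ := fun j => Ioc ((j : ℝ) / n) (((j : ℝ) + 1) / n) with hI
    have hlen : ∀ j : ℕ, ((j : ℝ) + 1) / n - j / n = 1 / n := fun j => by ring
    have hest := fun j : ℕ => lintegral_iSup_fracSchrodinger_le hα0 hR0 hB0 hA0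
      (fun t w ht => hB t w ht) hμC (hA μ _ hμC R hR0) hf (I := I j)
      ⟨((j : ℝ) + 1) / n, by gcongr; linarith, le_refl _⟩ (fun t ht t' ht' => by
        have h1 : |t - t'| ≤ 1 / n := by
          have := hlen j
          rw [abs_le]; constructor <;> linarith [ht.1, ht.2, ht'.1, ht'.2]
        calc |t - t'| * R ^ α ≤ 1 / n * n := by gcongr
          _ = 1 := by field_simp)
    have hcover : ∀ x, maximalFunction α f x ^ 2 ≤
        ∑ j ∈ Finset.range n, (⨆ t ∈ I j, ‖fracSchrodinger α t f x‖ₑ) ^ 2 := by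
      intro x
      have hsup : maximalFunction α f x ≤
          (Finset.range n).sup fun j => ⨆ t ∈ I j, ‖fracSchrodinger α t f x‖ₑ := by
        refine iSup₂_le fun t ht => ?_
        have htn : 0 < t * n := mul_pos ht.1 hn0
        have hce1 := Nat.le_ceil (t * n)
        have hce2 := Nat.ceil_lt_add_one htn.le
        have hce0 : 0 < ⌈t * n⌉₊ := Nat.ceil_pos.2 htn
        -- The intervals are open on the left and closed on the right, so the index of `t` is `⌈t *
        -- n⌉₊ - 1`.
        obtain ⟨j, hj⟩ : ∃ j, ⌈t * n⌉₊ = j + 1 := ⟨⌈t * n⌉₊ - 1, by omega⟩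
        rw [hj] at hce1 hce2
        push_cast at hce1 hce2
        have hjn : j ∈ Finset.range n := by
          rw [Finset.mem_range]
          have : (j : ℝ) < n := by nlinarith [ht.2]
          exact_mod_cast this
        have htI : t ∈ I j := by
          constructor
          · rw [div_lt_iff₀ hn0]; linarith
          · rw [le_div_iff₀ hn0]; exact hce1
        exact (le_iSup₂ (f := fun t (_ : t ∈ I j) => ‖fracSchrodinger α t f x‖ₑ) t htI).trans
          (Finset.le_sup (f := fun j => ⨆ t ∈ I j, ‖fracSchrodinger α t f x‖ₑ) hjn)
      have hne : (Finset.range n).Nonempty :=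
        Finset.nonempty_range_iff.2 (by rintro h; rw [h] at hn0; simp at hn0)
      obtain ⟨j, hj, hje⟩ := Finset.exists_mem_eq_sup _ hne
        fun j => ⨆ t ∈ I j, ‖fracSchrodinger α t f x‖ₑ
      rw [hje] at hsup
      exact (pow_le_pow_left' hsup 2).trans (Finset.single_le_sum
        (f := fun j => (⨆ t ∈ I j, ‖fracSchrodinger α t f x‖ₑ) ^ 2) (fun _ _ => zero_le) hj)
    calc ∫⁻ x in ball 0 1, maximalFunction α f x ^ 2 ∂μ
        ≤ ∫⁻ x in ball 0 1, ∑ j ∈ Finset.range n, (⨆ t ∈ I j, ‖fracSchrodinger α t f x‖ₑ) ^ 2 ∂μ :=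
          lintegral_mono hcover
      _ = ∑ j ∈ Finset.range n, ∫⁻ x in ball 0 1, (⨆ t ∈ I j, ‖fracSchrodinger α t f x‖ₑ) ^ 2 ∂μ :=
          lintegral_finsetSum _ fun j _ => (hest j).1.pow_const 2
      _ ≤ ∑ j ∈ Finset.range n,
          ENNReal.ofReal (R ^ d * B * (A * (dimConst γ μ * R ^ (-γ)))) * ‖f‖ₑ ^ 2 :=
          Finset.sum_le_sum fun j _ => (hest j).2
      _ = ENNReal.ofReal (n * (R ^ d * B * (A * (dimConst γ μ * R ^ (-γ))))) * ‖f‖ₑ ^ 2 := by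
          rw [Finset.sum_const, Finset.card_range, nsmul_eq_mul,
            ← mul_assoc, ENNReal.ofReal_mul (p := (n : ℝ)) (Nat.cast_nonneg n), ENNReal.ofReal_natCast]
      _ ≤ _ := by
          refine mul_le_mul_left (ENNReal.ofReal_le_ofReal ?_) _
          have e2 : R ^ ((d : ℝ) - γ + 2 * s) = R ^ d * R ^ (-γ) * R ^ (2 * s) := by
            rw [← Real.rpow_natCast, ← Real.rpow_add hR0, ← Real.rpow_add hR0]; congr 1
          have e3 : (n : ℝ) ≤ 2 * R ^ (2 * s) := hn2.trans (mul_le_mul_of_nonneg_left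
            (Real.rpow_le_rpow_of_exponent_le hR (by linarith)) (by norm_num))
          rw [e2]
          calc (n : ℝ) * (R ^ d * B * (A * (dimConst γ μ * R ^ (-γ))))
              ≤ 2 * R ^ (2 * s) * (R ^ d * B * (A * (dimConst γ μ * R ^ (-γ)))) := by gcongr
            _ = _ := by ring

theorem proposition3p4 (d : ℕ) (hd : 1 ≤ d) (α : ℝ) (hα0 : 0 < α) (hα1 : α < 1)
    (γ : ℝ) (hγ0 : 0 < γ) (hγd : γ ≤ d) (s : ℝ)
    (hs : min (max 0 (α * (γ / 2 - (d : ℝ) / 4))) (α / 2) < s) :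
    ∃ C : ℝ, 0 < C ∧
      ∀ μ : Measure (Rd d), IsGammaDimensional γ μ →
      ∀ R : ℝ, 1 ≤ R →
      ∀ f : Lp ℂ 2 (volume : Measure (Rd d)), FourierSupportedInAnnulus R f →
        eLpNorm (maximalFunction α f) 2 (μ.restrict (ball 0 1)) ≤
          ENNReal.ofReal (C * R ^ (((d : ℝ) - γ) / 2 + s) *
            Real.sqrt (dimConst γ μ : ℝ) * ‖f‖) := by
  obtain ⟨C, hC0, hC⟩ := exists_lintegral_maximalFunction_sq_le hd hα0 hα1 hγ0 hs
  -- The summand `1` keeps the constant positive when `C = 0`.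
  refine ⟨√C + 1, by positivity, fun μ hμ R hR f hf => ?_⟩
  have hR0 : 0 < R := by linarith
  rw [eLpNorm_eq_lintegral_rpow_enorm_toReal (by norm_num) (by norm_num)]
  simp only [ENNReal.toReal_ofNat, enorm_eq_self, one_div]
  rw [ENNReal.rpow_inv_le_iff (by norm_num), ENNReal.rpow_ofNat]
  simp only [ENNReal.rpow_ofNat]
  refine (hC μ hμ R hR f hf).trans ?_
  rw [← ofReal_norm, ← ENNReal.ofReal_pow (norm_nonneg _), ← ENNReal.ofReal_pow (by positivity),
    ← ENNReal.ofReal_mul (by positivity)]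
  apply ENNReal.ofReal_le_ofReal
  have e1 : R ^ ((d : ℝ) - γ + 2 * s) = (R ^ (((d : ℝ) - γ) / 2 + s)) ^ 2 := by
    rw [← Real.rpow_natCast, ← Real.rpow_mul hR0.le]; congr 1; push_cast; ring
  have e2 : √(dimConst γ μ : ℝ) ^ 2 = dimConst γ μ := Real.sq_sqrt (NNReal.coe_nonneg _)
  have e3 : C ≤ (√C + 1) ^ 2 := by
    nlinarith [Real.sq_sqrt hC0, Real.sqrt_nonneg C]
  rw [e1, mul_pow, mul_pow, mul_pow, e2]
  gcongr
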